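/- Let $X$ be a non-empty metric space and let $B(x,r)$ denote the closed ball with centre $x$ and radius $r$. For $E\subset X$ and $r>0$, let $N_r(E)$ be the least number of closed balls of radius $r$ (with centres in $X$) required to cover $E$, and let $P_r(E)$ be the maximal cardinality of a subset of $E$ whose distinct points have distance strictly larger than $4r$. For $0<\theta<1$ the *lower spectrum* of $X$ is $$\dim_{\mathrm L}^{\theta}X=\sup\Bigl\{s\ge 0:\exists C>0\ \forall\, 0<r<1\quad \inf_{x\in X}N_r(B(x,r^\theta))\ge C\Bigl(\frac{r^\theta}{r}\Bigr)^{s}\Bigr\}.$$ At $\theta=1$, the expression $(1-\theta)\dim_{\mathrm L}^{\theta}X$ is defined as its limit as $\theta\to1^-$. For real $v\le u$ put $$\underline{\beta}_X(u,v)=\log_2\inf_{x\in X}P_{2^{-u}}(B(x,2^{-v})),\qquad \overline{\beta}_X(u,v)=\log_2\sup_{x\in X}N_{2^{-u}}(B(x,2^{-v})).$$ The space $X$ is called *uniform* if there is a function $\eta\colon\mathbb R\to\mathbb R$ with $\lim_{u\to\infty}\eta(u)/u=0$ and $\overline{\beta}_X(u,v)\le\underline{\beta}_X(u,v)+\eta(u)$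 for all real $v\le u$. **Theorem.** Let $d\in\mathbb N$ and let $\varphi\colon(0,1]\to[0,d]$. Then there is a non-empty uniform set $F\subset\mathbb R^d$ (with the Euclidean metric) such that $(1-\theta)\dim_{\mathrm L}^{\theta}F=\varphi(\theta)$ for all $\theta\in(0,1]$ if and only if $\varphi$ is $d$-Lipschitz and $$\varphi(\theta)\le\varphi(\lambda\theta)-\theta\varphi(\lambda)\qquad\text{for all }\lambda,\theta\in(0,1].$$ Moreover, for $d\ge1$, the class of functions $\varphi\colon(0,1]\to[0,d]$ that satisfy the latter two conditions is a proper subset of the class of functions $\varphi\colon(0,1]\to[0,d]$ that satisfy $$\varphi(\theta)\le\varphi(\lambda\theta)-\theta\varphi(\lambda)\le(1-\theta)d\qquad\text{for all }\lambda,\theta\in(0,1].$$ -/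

import Mathlib

open Set Filter Topology
open scoped NNReal ENNReal

noncomputable section

/-- `N_r(E)`: the least number (in `ℕ∞`) of closed balls of radius `r`, centred in the metric
space `X`, that are required to cover `E ⊆ X`. -/
def coverNum {X : Type*} [MetricSpace X] (r : ℝ≥0) (E : Set X) : ℕ∞ :=
  Metric.externalCoveringNumber r E

/-- `P_r(E)`: the maximal cardinality (in `ℕ∞`) of a subset of `E` any two distinct points of
which have distance strictly larger than `4 r`. -/
def packNum {X : Type*} [MetricSpace X] (r : ℝ≥0) (E : Set X) : ℕ∞ :=
  Metric.packingNumber (4 * r) E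

/-- The logarithm in base `2` of an element of `ℕ∞`, with values in the extended reals. -/
def logTwo (n : ℕ∞) : EReal :=
  ENNReal.log (n : ℝ≥0∞) / ((Real.log 2 : ℝ) : EReal)

/-- The infimal two-scale branching function
`(u, v) ↦ log₂ inf_{x ∈ X} P_{2^{-u}}(B(x, 2^{-v}))`. -/
def lowerBranching (X : Type*) [MetricSpace X] (u v : ℝ) : EReal :=
  logTwo (⨅ x : X, packNum ((2 : ℝ≥0) ^ (-u)) (Metric.closedBall x ((2 : ℝ) ^ (-v))))

/-- The supremal two-scale branching function
`(u, v) ↦ log₂ sup_{x ∈ X} N_{2^{-u}}(B(x, 2^{-v}))`. -/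
def upperBranching (X : Type*) [MetricSpace X] (u v : ℝ) : EReal :=
  logTwo (⨆ x : X, coverNum ((2 : ℝ≥0) ^ (-u)) (Metric.closedBall x ((2 : ℝ) ^ (-v))))

/-- `X` is `η`-uniform: `η(u) / u → 0` as `u → ∞`, and the supremal two-scale branching function
exceeds the infimal one by at most `η(u)`, for all real `v ≤ u`. -/
def IsUniformWith (X : Type*) [MetricSpace X] (η : ℝ → ℝ) : Prop :=
  Tendsto (fun u => u⁻¹ * η u) atTop (𝓝 0) ∧
    ∀ u v : ℝ, v ≤ u → upperBranching X u v ≤ lowerBranching X u v + ((η u : ℝ) : EReal)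

/-- `X` is uniform if it is `η`-uniform for some `η : ℝ → ℝ`. -/
def IsUniformSpaceAtScales (X : Type*) [MetricSpace X] : Prop :=
  ∃ η : ℝ → ℝ, IsUniformWith X η

/-- The `θ`-lower spectrum of `X`, meant for `0 < θ < 1`: the supremum of the `s ≥ 0` for which
there is `C > 0` with `inf_{x ∈ X} N_r(B(x, r^θ)) ≥ C (r^θ / r)^s` for all `0 < r < 1`. -/
def lowerSpectrum (θ : ℝ) (X : Type*) [MetricSpace X] : ℝ≥0∞ :=
  ⨆ s ∈ {s : ℝ≥0 | ∃ C : ℝ, 0 < C ∧ ∀ r : ℝ≥0, 0 < r → r < 1 →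
      ENNReal.ofReal (C * ((r : ℝ) ^ θ / (r : ℝ)) ^ (s : ℝ)) ≤
        ((⨅ x : X, coverNum r (Metric.closedBall x ((r : ℝ) ^ θ)) : ℕ∞) : ℝ≥0∞)},
    (s : ℝ≥0∞)

/-- `(1 - θ) dim_L^θ X = φ(θ)` for all `θ ∈ (0, 1]`, where the value of the left side at `θ = 1` is
by definition its limit as `θ → 1` from below. It is used for `φ` nonnegative on `(0, 1]`. -/
def HasScaledLowerSpectrum (X : Type*) [MetricSpace X] (φ : ℝ → ℝ) : Prop :=
  (∀ θ ∈ Ioo (0 : ℝ) 1, ENNReal.ofReal (1 - θ) * lowerSpectrum θ X = ENNReal.ofReal (φ θ)) ∧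
    Tendsto (fun θ : ℝ => ENNReal.ofReal (1 - θ) * lowerSpectrum θ X) (𝓝[<] 1)
      (𝓝 (ENNReal.ofReal (φ 1)))

/-- The functions `φ : (0, 1] → [0, d]` that are `d`-Lipschitz and satisfy
`φ(θ) ≤ φ(λθ) - θ φ(λ)` for all `λ, θ ∈ (0, 1]`. (Values outside `(0, 1]` play no role.) -/
def classU (d : ℕ) : Set (ℝ → ℝ) :=
  {φ | MapsTo φ (Ioc 0 1) (Icc 0 (d : ℝ)) ∧
    LipschitzOnWith (d : ℝ≥0) φ (Ioc 0 1) ∧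
    ∀ l ∈ Ioc (0 : ℝ) 1, ∀ θ ∈ Ioc (0 : ℝ) 1, φ θ ≤ φ (l * θ) - θ * φ l}

/-- The functions `φ : (0, 1] → [0, d]` that satisfy
`φ(θ) ≤ φ(λθ) - θ φ(λ) ≤ (1 - θ) d` for all `λ, θ ∈ (0, 1]`. (Values outside `(0, 1]` play no
role.) -/
def classH (d : ℕ) : Set (ℝ → ℝ) :=
  {φ | MapsTo φ (Ioc 0 1) (Icc 0 (d : ℝ)) ∧
    ∀ l ∈ Ioc (0 : ℝ) 1, ∀ θ ∈ Ioc (0 : ℝ) 1,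
      φ θ ≤ φ (l * θ) - θ * φ l ∧ φ (l * θ) - θ * φ l ≤ (1 - θ) * d}

end

noncomputable section

/-! Put scales on a logarithmic axis: for a uniform set the logarithms of the infimal packing
number, the infimal covering number and the supremal covering number of balls of radius `2 ^ (-v)`
at scale `2 ^ (-u)` agree up to `o(u)`, and `(1 - θ) dim_L^θ` is the liminf of their common size at
`(u, θ u)`, divided by `u` (`ofReal_mul_lowerSpectrum_eq_iff`).

Necessity: packing numbers are supermultiplicative across an intermediate scale, covering numbers
submultiplicative. Taking the liminf at the scales `u`, `θ u`, `l θ u` gives the functional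
inequality. Submultiplicativity and the trivial bound `d (u - v) + O(1)` in `ℝ^d` give the Lipschitz
bound (`lipschitzOn_and_superadd_of_hasScaledLiminf`).

Sufficiency: the inequality says that the kernel `g u v = u * φ (v / u)` is superadditive, and the
Lipschitz condition bounds its increments. It suffices to find a monotone profile `f` with
increments at most `d` such that `f u - f v ≥ g u v - o(u)`, with equality for infinitely many `u`
and all `v ≥ δ u`. The profile is built in blocks: a stretch of slope `d`, long enough to make the
past negligible, followed by `v ↦ -g U v` up to the end `U` of the block, which is much longer
still. Equality then holds at `u = U`, and superadditivity gives the inequality inside the block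
(`IsScaleKernel.eventually_le_profile_sub`, `IsScaleKernel.frequently_profile_sub_eq`). Finally, `f`
becomes a set: restrict binary expansions so that about `f (k + 1) - f k` coordinates have a free
digit at level `k` (`exists_set_realLogTwo_near`). -/

/-- Superadditive kernels on `{(u, v) : 0 < v ≤ u}` that are nonnegative and one-sidedly
`d`-Lipschitz in each variable. -/
structure IsScaleKernel (d : ℝ) (g : ℝ → ℝ → ℝ) : Prop where
  nonneg : ∀ {u v : ℝ}, 0 < v → v ≤ u → 0 ≤ g u v
  superadd : ∀ {u v w : ℝ}, 0 < w → w ≤ v → v ≤ u → g u v + g v w ≤ g u w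
  lip_right : ∀ {u v w : ℝ}, 0 < w → w ≤ v → v ≤ u → g u w ≤ g u v + d * (v - w)
  lip_left : ∀ {u v w : ℝ}, 0 < w → w ≤ v → v ≤ u → g u w ≤ g v w + d * (u - v)
  diag : ∀ {u : ℝ}, 0 < u → g u u = 0

/-! ### The superadditive kernel of a function `φ` -/

section Kernel

variable {φ : ℝ → ℝ} {d : ℕ}

lemma map_one_eq_zero_of_superadd (h0 : MapsTo φ (Ioc 0 1) (Icc 0 (d : ℝ)))
    (h2 : ∀ l ∈ Ioc (0 : ℝ) 1, ∀ θ ∈ Ioc (0 : ℝ) 1, φ θ ≤ φ (l * θ) - θ * φ l) : φ 1 = 0 := by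
  have h := h2 1 (by simp) 1 (by simp)
  have h' := (h0 (show (1 : ℝ) ∈ Ioc 0 1 by simp)).1
  simp at h
  linarith

lemma le_add_of_lipschitzOn (h1 : LipschitzOnWith (d : ℝ≥0) φ (Ioc 0 1)) {s t : ℝ}
    (hs : 0 < s) (hst : s ≤ t) (ht : t ≤ 1) : φ s ≤ φ t + d * (t - s) := by
  have h := h1.dist_le_mul s ⟨hs, hst.trans ht⟩ t ⟨hs.trans_le hst, ht⟩
  rw [Real.dist_eq, Real.dist_eq, abs_sub_comm s t, abs_of_nonneg (sub_nonneg.2 hst)] at h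
  have := (le_abs_self _).trans h
  simp at this
  linarith

lemma isScaleKernel_of_superadd (h0 : MapsTo φ (Ioc 0 1) (Icc 0 (d : ℝ)))
    (h1 : LipschitzOnWith (d : ℝ≥0) φ (Ioc 0 1))
    (h2 : ∀ l ∈ Ioc (0 : ℝ) 1, ∀ θ ∈ Ioc (0 : ℝ) 1, φ θ ≤ φ (l * θ) - θ * φ l) :
    IsScaleKernel d (fun u v => u * φ (v / u)) where
  nonneg {u v} hv hvu := by
    have hu := hv.trans_le hvu
    exact mul_nonneg hu.le (h0 ⟨by positivity, (div_le_one hu).2 hvu⟩).1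
  superadd {u v w} hw hwv hvu := by
    have hv := hw.trans_le hwv
    have hu := hv.trans_le hvu
    have h := h2 (w / v) ⟨by positivity, (div_le_one hv).2 hwv⟩ (v / u)
      ⟨by positivity, (div_le_one hu).2 hvu⟩
    have e : w / v * (v / u) = w / u := by field_simp
    rw [e] at h
    have h' := mul_le_mul_of_nonneg_left h hu.le
    have e' : u * (φ (w / u) - v / u * φ (w / v)) = u * φ (w / u) - v * φ (w / v) := by
      field_simp
    rw [e'] at h'
    show u * φ (v / u) + v * φ (w / v) ≤ u * φ (w / u)
    linarith
  lip_right {u v w} hw hwv hvu := by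
    have hv := hw.trans_le hwv
    have hu := hv.trans_le hvu
    have h := le_add_of_lipschitzOn h1 (s := w / u) (t := v / u) (by positivity) (by gcongr)
      ((div_le_one hu).2 hvu)
    have h' := mul_le_mul_of_nonneg_left h hu.le
    have e' : u * (φ (v / u) + d * (v / u - w / u)) = u * φ (v / u) + d * (v - w) := by
      field_simp
    rwa [e'] at h'
  lip_left {u v w} hw hwv hvu := by
    have hv := hw.trans_le hwv
    have hu := hv.trans_le hvu
    have h := le_add_of_lipschitzOn h1 (s := w / u) (t := w / v) (by positivity) (by gcongr)
      ((div_le_one hv).2 hwv)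
    have h' := mul_le_mul_of_nonneg_left h hu.le
    -- Since `φ 1 = 0`, this bounds `φ (w / v)` by `d * (1 - w / v)`, which pays for replacing the
    -- factor `u` by `v`.
    have h3 := le_add_of_lipschitzOn h1 (s := w / v) (t := 1) (by positivity)
      ((div_le_one hv).2 hwv) le_rfl
    rw [map_one_eq_zero_of_superadd h0 h2] at h3
    have h4 := mul_le_mul_of_nonneg_left h3 (sub_nonneg.2 hvu)
    have e : u * (φ (w / v) + d * (w / v - w / u)) + (u - v) * (0 + d * (1 - w / v)) =
        u * φ (w / v) + d * (u - v) := by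
      field_simp; ring
    show u * φ (w / u) ≤ v * φ (w / v) + d * (u - v)
    linarith
  diag {u} hu := by
    simp [div_self hu.ne', map_one_eq_zero_of_superadd h0 h2]

end Kernel

/-! ### A one-variable profile that realizes the kernel in the liminf -/

section Profile

/-- The `n`-th block of scales starts at `blockStart n`. -/
def blockStart (n : ℕ) : ℕ := 2 ^ (n ^ 2)

/-- The end of the initial part of slope `d` of the `n`-th block of scales. -/
def rampEnd (n : ℕ) : ℕ := 2 ^ (n ^ 2 + n)

/-- The index of the block of scales that contains `k`. -/
def blockIndex (k : ℕ) : ℕ := Nat.sqrt (Nat.log 2 k)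

/-- The profile in the `n`-th block of scales, up to an additive constant. -/
def blockProfile (d : ℝ) (g : ℝ → ℝ → ℝ) (n : ℕ) (v : ℝ) : ℝ :=
  d * min v (rampEnd n) - g (blockStart (n + 1)) (max v (rampEnd n))

/-- The profile obtained by joining the profiles in the blocks. -/
def profile (d : ℝ) (g : ℝ → ℝ → ℝ) (k : ℕ) : ℝ :=
  ∑ j ∈ Finset.range k,
    (blockProfile d g (blockIndex j) (j + 1) - blockProfile d g (blockIndex j) j)

lemma blockStart_pos (n : ℕ) : 0 < blockStart n := by unfold blockStart; positivity

lemma rampEnd_pos (n : ℕ) : 0 < rampEnd n := by unfold rampEnd; positivity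

lemma rampEnd_eq (n : ℕ) : rampEnd n = 2 ^ n * blockStart n := by
  unfold rampEnd blockStart; ring

lemma blockStart_succ (n : ℕ) : blockStart (n + 1) = 2 ^ (n + 1) * rampEnd n := by
  unfold rampEnd blockStart; ring

lemma blockStart_le_rampEnd (n : ℕ) : blockStart n ≤ rampEnd n := by
  rw [rampEnd_eq]; exact Nat.le_mul_of_pos_left _ (by positivity)

lemma rampEnd_le_blockStart_succ (n : ℕ) : rampEnd n ≤ blockStart (n + 1) := by
  rw [blockStart_succ]; exact Nat.le_mul_of_pos_left _ (by positivity)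

lemma blockIndex_eq {n k : ℕ} (h1 : blockStart n ≤ k) (h2 : k < blockStart (n + 1)) :
    blockIndex k = n := by
  have hk : k ≠ 0 := ((blockStart_pos n).trans_le h1).ne'
  unfold blockIndex blockStart at *
  have a1 : n ^ 2 ≤ Nat.log 2 k := Nat.le_log_of_pow_le (by norm_num) h1
  have a2 : Nat.log 2 k < (n + 1) ^ 2 := Nat.log_lt_of_lt_pow hk h2
  refine le_antisymm ?_ (Nat.le_sqrt'.2 a1)
  exact Nat.lt_succ_iff.1 (Nat.sqrt_lt'.2 a2)

lemma blockStart_blockIndex_le {k : ℕ} (hk : k ≠ 0) : blockStart (blockIndex k) ≤ k := by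
  unfold blockStart blockIndex
  exact (Nat.pow_le_pow_right (by norm_num) (Nat.sqrt_le' _)).trans (Nat.pow_log_le_self 2 hk)

lemma lt_blockStart_blockIndex_succ (k : ℕ) : k < blockStart (blockIndex k + 1) := by
  unfold blockStart blockIndex
  exact (Nat.lt_pow_succ_log_self (by norm_num) k).trans_le
    (Nat.pow_le_pow_right (by norm_num) (Nat.lt_succ_sqrt' _))

variable {d : ℝ} {g : ℝ → ℝ → ℝ}

lemma IsScaleKernel.anti_right (hg : IsScaleKernel d g) {u v w : ℝ} (hw : 0 < w) (hwv : w ≤ v)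
    (hvu : v ≤ u) : g u v ≤ g u w := by
  have := hg.superadd hw hwv hvu
  have := hg.nonneg hw hwv
  linarith

lemma IsScaleKernel.le_mul (hg : IsScaleKernel d g) {u v : ℝ} (hv : 0 < v)
    (hvu : v ≤ u) : g u v ≤ d * (u - v) := by
  have := hg.lip_right hv hvu le_rfl
  rw [hg.diag (hv.trans_le hvu)] at this
  linarith

lemma IsScaleKernel.blockProfile_sub_mem (hg : IsScaleKernel d g) (hd : 0 ≤ d) {n : ℕ} {v w : ℝ}
    (hvw : v ≤ w) (hw : w ≤ blockStart (n + 1)) :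
    blockProfile d g n w - blockProfile d g n v ∈ Icc 0 (d * (w - v)) := by
  have ha : (0 : ℝ) < rampEnd n := by exact_mod_cast rampEnd_pos n
  have haU : (rampEnd n : ℝ) ≤ blockStart (n + 1) := by
    exact_mod_cast rampEnd_le_blockStart_succ n
  have hm : max v (rampEnd n : ℝ) ≤ max w (rampEnd n) := max_le_max_right _ hvw
  have h1 := hg.anti_right (lt_max_of_lt_right ha) hm (max_le hw haU)
  have h2 := hg.lip_right (lt_max_of_lt_right ha) hm (max_le hw haU)
  have e1 := min_add_max v (rampEnd n : ℝ)
  have e2 := min_add_max w (rampEnd n : ℝ)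
  have h3 : d * min v (rampEnd n : ℝ) ≤ d * min w (rampEnd n : ℝ) := by gcongr
  have h4 : d * (max w (rampEnd n) - max v (rampEnd n)) +
      d * (min w (rampEnd n) - min v (rampEnd n)) = d * (w - v) := by
    rw [← mul_add]; congr 1; linarith
  unfold blockProfile
  constructor <;> linarith

/-- On the ramp, slope `d` is the largest growth that `g` allows. Beyond it, with `U` the end of the
block, `g U v - g U w ≥ g w v` is superadditivity. A pair straddling the end of the ramp combines
both. -/
lemma IsScaleKernel.le_blockProfile_sub (hg : IsScaleKernel d g) {n : ℕ} {v w : ℝ}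
    (hv : 0 < v) (hvw : v ≤ w) (hw : w ≤ blockStart (n + 1)) :
    g w v ≤ blockProfile d g n w - blockProfile d g n v := by
  have ha : (0 : ℝ) < rampEnd n := by exact_mod_cast rampEnd_pos n
  have haU : (rampEnd n : ℝ) ≤ blockStart (n + 1) := by
    exact_mod_cast rampEnd_le_blockStart_succ n
  unfold blockProfile
  rcases le_total w (rampEnd n : ℝ) with h | h
  · rw [min_eq_left h, min_eq_left (hvw.trans h), max_eq_right h, max_eq_right (hvw.trans h)]
    linarith [hg.le_mul hv hvw]
  rcases le_total v (rampEnd n : ℝ) with h' | h'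
  · rw [min_eq_right h, min_eq_left h', max_eq_left h, max_eq_right h']
    have := hg.superadd ha h hw
    have := hg.lip_right hv h' h
    linarith
  · rw [min_eq_right h, min_eq_right h', max_eq_left h, max_eq_left h']
    linarith [hg.superadd hv hvw hw]

lemma profile_sub_eq {n j k : ℕ} (hj : blockStart n ≤ j) (hjk : j ≤ k)
    (hk : k ≤ blockStart (n + 1)) :
    profile d g k - profile d g j = blockProfile d g n k - blockProfile d g n j := by
  induction k, hjk using Nat.le_induction with
  | base => simp
  | succ k hjk ih =>
    have h := ih (by omega)
    have hi : blockIndex k = n := blockIndex_eq (by omega) (by omega)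
    have e : profile d g (k + 1) = profile d g k +
        (blockProfile d g n (k + 1) - blockProfile d g n k) := by
      rw [profile, Finset.sum_range_succ, hi]; rfl
    rw [e]; push_cast; linarith

lemma IsScaleKernel.profile_succ_sub_mem (hg : IsScaleKernel d g) (hd : 0 ≤ d) (k : ℕ) :
    profile d g (k + 1) - profile d g k ∈ Icc 0 d := by
  have h : (k : ℝ) + 1 ≤ blockStart (blockIndex k + 1) := by
    exact_mod_cast lt_blockStart_blockIndex_succ k
  have := hg.blockProfile_sub_mem hd (v := k) (w := k + 1) (by linarith) h
  rw [add_sub_cancel_left, mul_one] at this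
  rw [profile, Finset.sum_range_succ, profile, add_sub_cancel_left]
  exact this

lemma IsScaleKernel.profile_mono (hg : IsScaleKernel d g) (hd : 0 ≤ d) :
    Monotone (profile d g) :=
  monotone_nat_of_le_succ fun k => by linarith [(hg.profile_succ_sub_mem hd k).1]

lemma IsScaleKernel.le_profile_sub_of_block (hg : IsScaleKernel d g) {n j k : ℕ}
    (hj : blockStart n ≤ j) (hjk : j ≤ k) (hk : k ≤ blockStart (n + 1)) :
    g k j ≤ profile d g k - profile d g j := by
  rw [profile_sub_eq hj hjk hk]
  have : 0 < j := (blockStart_pos n).trans_le hj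
  exact hg.le_blockProfile_sub (by exact_mod_cast this) (by exact_mod_cast hjk)
    (by exact_mod_cast hk)

/-- Anything before the last block changes `g` by at most `d * blockStart n`, so monotonicity of the
profile suffices there. -/
lemma IsScaleKernel.le_profile_blockStart_sub (hg : IsScaleKernel d g) (hd : 0 ≤ d) {n j : ℕ}
    (hj : 0 < j) (hjn : j ≤ blockStart (n + 1)) :
    g (blockStart (n + 1)) j - d * blockStart n ≤
      profile d g (blockStart (n + 1)) - profile d g j := by
  have hS : blockStart n ≤ blockStart (n + 1) :=
    (blockStart_le_rampEnd n).trans (rampEnd_le_blockStart_succ n)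
  rcases le_total (blockStart n) j with h | h
  · have := hg.le_profile_sub_of_block h hjn le_rfl
    have : 0 ≤ d * blockStart n := by positivity
    linarith
  · have h1 := hg.le_profile_sub_of_block le_rfl hS le_rfl
    have h2 := hg.lip_right (u := blockStart (n + 1)) (v := blockStart n) (w := j)
      (by exact_mod_cast hj) (by exact_mod_cast h) (by exact_mod_cast hS)
    have h3 := hg.profile_mono hd h
    have : 0 ≤ d * j := by positivity
    linarith

lemma IsScaleKernel.le_profile_sub (hg : IsScaleKernel d g) (hd : 0 ≤ d) {n j k : ℕ}
    (hj : 0 < j) (hjk : j ≤ k) (hnk : blockStart (n + 1) ≤ k) (hkn : k ≤ blockStart (n + 2)) :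
    g k j - d * (k / 2 ^ n) ≤ profile d g k - profile d g j := by
  have hj' : (0 : ℝ) < j := by exact_mod_cast hj
  have hpos : 0 ≤ d * (k / 2 ^ n : ℝ) := by positivity
  rcases le_total (blockStart (n + 1)) j with h | h
  · linarith [hg.le_profile_sub_of_block h hjk hkn]
  have h' : (j : ℝ) ≤ blockStart (n + 1) := by exact_mod_cast h
  have hnk' : (blockStart (n + 1) : ℝ) ≤ k := by exact_mod_cast hnk
  have hU : (0 : ℝ) < blockStart (n + 1) := by exact_mod_cast blockStart_pos (n + 1)
  have h1 := hg.le_profile_sub_of_block le_rfl hnk hkn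
  -- On the ramp the profile gains `d` per step since the block start `U`, and `g` cannot gain more
  -- by `lip_left`, so the bound at `U` persists. Beyond the ramp, `U` is at most `k / 2 ^ n`, so
  -- everything before `U` is absorbed in the error.
  rcases le_total k (rampEnd (n + 1)) with hr | hr
  · have h2 := hg.le_profile_blockStart_sub hd hj h
    have h3 := profile_sub_eq (d := d) (g := g) le_rfl hnk hkn
    have hr' : (k : ℝ) ≤ rampEnd (n + 1) := by exact_mod_cast hr
    unfold blockProfile at h3
    rw [min_eq_left hr', min_eq_left (hnk'.trans hr'), max_eq_right hr',
      max_eq_right (hnk'.trans hr')] at h3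
    have h4 := hg.lip_left hj' h' hnk'
    have h5 : d * (blockStart n : ℝ) ≤ d * (k / 2 ^ n) := by
      gcongr
      rw [le_div_iff₀ (by positivity)]
      refine le_trans ?_ hnk'
      have : blockStart n * 2 ^ n ≤ blockStart (n + 1) := by
        rw [mul_comm, ← rampEnd_eq]; exact rampEnd_le_blockStart_succ n
      exact_mod_cast this
    linarith
  · have h2 := hg.lip_right hj' h' hnk'
    have h3 := hg.profile_mono hd h
    have h5 : d * (blockStart (n + 1) : ℝ) ≤ d * (k / 2 ^ n) := by
      gcongr
      rw [le_div_iff₀ (by positivity)]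
      have : blockStart (n + 1) * 2 ^ n ≤ k := by
        refine le_trans ?_ hr
        rw [rampEnd_eq, mul_comm]
        gcongr <;> omega
      exact_mod_cast this
    have : 0 ≤ d * j := by positivity
    linarith

lemma IsScaleKernel.eventually_le_profile_sub (hg : IsScaleKernel d g) (hd : 0 ≤ d) {ε : ℝ}
    (hε : 0 < ε) : ∀ᶠ k : ℕ in atTop, ∀ j : ℕ, 0 < j → j ≤ k →
      g k j - ε * k ≤ profile d g k - profile d g j := by
  have ht : Tendsto (fun n : ℕ => d * (1 / 2 : ℝ) ^ n) atTop (𝓝 (d * 0)) :=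
    (tendsto_pow_atTop_nhds_zero_of_lt_one (by norm_num) (by norm_num)).const_mul d
  rw [mul_zero] at ht
  obtain ⟨N, hN⟩ := eventually_atTop.1 (ht.eventually (eventually_le_nhds hε))
  filter_upwards [eventually_ge_atTop (blockStart (N + 1))] with k hk j hj hjk
  have hk0 : k ≠ 0 := by omega
  have hi : N + 1 ≤ blockIndex k := by
    by_contra! hlt
    have h1 := lt_blockStart_blockIndex_succ k
    have h2 : blockStart (blockIndex k + 1) ≤ blockStart (N + 1) := by
      unfold blockStart
      exact Nat.pow_le_pow_right (by norm_num) (Nat.pow_le_pow_left (by omega) 2)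
    omega
  obtain ⟨m, hm⟩ : ∃ m, blockIndex k = m + 1 := ⟨blockIndex k - 1, by omega⟩
  have h1 := hg.le_profile_sub hd hj hjk (n := m) (by rw [← hm]; exact blockStart_blockIndex_le hk0)
    (by have := lt_blockStart_blockIndex_succ k; rw [hm] at this; exact this.le)
  have h2 := mul_le_mul_of_nonneg_right (hN m (by omega)) (Nat.cast_nonneg (α := ℝ) k)
  have e : d * (k / 2 ^ m : ℝ) = d * (1 / 2) ^ m * k := by
    rw [div_pow, one_pow]; ring
  linarith

/-- The scales `k` are block ends: there the profile is `-g k` up to a constant from `rampEnd n` on,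
and `rampEnd n / k = 2 ^ (-(n + 1))` drops below any given `δ`. -/
lemma IsScaleKernel.frequently_profile_sub_eq (hg : IsScaleKernel d g) {δ : ℝ} (hδ : 0 < δ) :
    ∃ᶠ k : ℕ in atTop, ∀ j : ℕ, δ * k ≤ j → j ≤ k → profile d g k - profile d g j = g k j := by
  rw [frequently_atTop]
  intro K
  have ht : Tendsto (fun n : ℕ => (1 / 2 : ℝ) ^ n) atTop (𝓝 0) :=
    tendsto_pow_atTop_nhds_zero_of_lt_one (by norm_num) (by norm_num)
  obtain ⟨N, hN⟩ := eventually_atTop.1 (ht.eventually (eventually_le_nhds hδ))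
  set n := max N K
  have hU : n < blockStart (n + 1) := by
    unfold blockStart
    calc n < 2 ^ n := Nat.lt_two_pow_self
      _ ≤ _ := Nat.pow_le_pow_right (by norm_num) (by nlinarith)
  refine ⟨blockStart (n + 1), (le_max_right N K).trans hU.le, fun j hj hjk => ?_⟩
  have h1 : (rampEnd n : ℝ) ≤ j := by
    refine le_trans ?_ hj
    have h2 := hN n (le_max_left _ _)
    calc (rampEnd n : ℝ) ≤ (1 / 2) ^ n * blockStart (n + 1) := by
          rw [blockStart_succ, div_pow, one_pow, one_div, inv_mul_eq_div,
            le_div_iff₀ (by positivity)]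
          push_cast
          have : (0 : ℝ) ≤ rampEnd n := by positivity
          have : (0 : ℝ) ≤ 2 ^ n * rampEnd n := by positivity
          rw [pow_succ]; linarith
      _ ≤ _ := by gcongr
  have h2 : rampEnd n ≤ j := by exact_mod_cast h1
  have h3 : (rampEnd n : ℝ) ≤ blockStart (n + 1) := by
    exact_mod_cast rampEnd_le_blockStart_succ n
  rw [profile_sub_eq ((blockStart_le_rampEnd n).trans h2) hjk le_rfl]
  unfold blockProfile
  rw [min_eq_right h1, min_eq_right h3, max_eq_left h1, max_eq_left h3,
    hg.diag (by exact_mod_cast blockStart_pos _)]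
  ring

end Profile

/-! ### Strict inclusion of the two classes of functions -/

/-- For the inclusion, the Lipschitz bound between `l * θ` and `l` is combined with `φ l ≤ d * (1 -
l)`. The separating function is `d * max 0 (1 - 2 * t)`, whose slope `2 * d` is too steep only for
the Lipschitz condition. -/
lemma classU_ssubset_classH {d : ℕ} (hd : 0 < d) : classU d ⊂ classH d := by
  have hd' : (0 : ℝ) < d := by exact_mod_cast hd
  refine (ssubset_iff_of_subset ?_).2 ⟨fun t => d * max 0 (1 - 2 * t), ?_, ?_⟩
  · rintro φ ⟨h0, h1, h2⟩
    refine ⟨h0, fun l hl θ hθ => ⟨h2 l hl θ hθ, ?_⟩⟩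
    have h3 := le_add_of_lipschitzOn h1 (s := l * θ) (t := l) (mul_pos hl.1 hθ.1)
      (mul_le_of_le_one_right hl.1.le hθ.2) hl.2
    have h4 := le_add_of_lipschitzOn h1 hl.1 hl.2 le_rfl
    rw [map_one_eq_zero_of_superadd h0 h2] at h4
    have h5 := mul_le_mul_of_nonneg_left h4 (sub_nonneg.2 hθ.2)
    nlinarith
  · refine ⟨fun t ht => ⟨by positivity, ?_⟩, fun l hl θ hθ => ?_⟩
    · exact mul_le_of_le_one_right hd'.le (max_le zero_le_one (by linarith [ht.1]))
    · have a1 : max 0 (1 - 2 * θ) + θ * max 0 (1 - 2 * l) ≤ max 0 (1 - 2 * (l * θ)) := by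
        obtain ⟨hl0, hl1⟩ := hl
        obtain ⟨h0, h1⟩ := hθ
        have := mul_pos hl0 h0
        rcases max_cases 0 (1 - 2 * θ) with ⟨e, h⟩ | ⟨e, h⟩ <;>
        rcases max_cases 0 (1 - 2 * l) with ⟨e', h'⟩ | ⟨e', h'⟩ <;> rw [e, e']
        · simp
        · exact le_max_of_le_right (by nlinarith)
        · exact le_max_of_le_right (by nlinarith)
        · exact le_max_of_le_right (by nlinarith)
      have a2 : max 0 (1 - 2 * (l * θ)) ≤ θ * max 0 (1 - 2 * l) + (1 - θ) := by
        have h3 : θ * (1 - 2 * l) ≤ θ * max 0 (1 - 2 * l) :=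
          mul_le_mul_of_nonneg_left (le_max_right _ _) hθ.1.le
        have h4 : 0 ≤ θ * max 0 (1 - 2 * l) := mul_nonneg hθ.1.le (le_max_left _ _)
        exact max_le (by linarith [hθ.2]) (by linarith)
      have b1 := mul_le_mul_of_nonneg_left a1 hd'.le
      have b2 := mul_le_mul_of_nonneg_left a2 hd'.le
      constructor <;> simp only <;> linarith
  · rintro ⟨-, h1, -⟩
    have h := le_add_of_lipschitzOn h1 (s := 1 / 4) (t := 1 / 2) (by norm_num) (by norm_num)
      (by norm_num)
    norm_num at h
    linarith

/-! ### Covering and packing numbers across an intermediate scale -/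

section Metric

variable {X : Type*} [MetricSpace X]

lemma exists_finset_cover_of_coverNum_le {r : ℝ≥0} {A : Set X} {m : ℕ} (h : coverNum r A ≤ m) :
    ∃ C : Finset X, C.card ≤ m ∧ ∀ x ∈ A, ∃ y ∈ C, dist x y ≤ r := by
  have h' : coverNum r A < (m + 1 : ℕ) := h.trans_lt (by exact_mod_cast Nat.lt_succ_self m)
  unfold coverNum Metric.externalCoveringNumber at h'
  simp only [iInf_lt_iff] at h'
  obtain ⟨C, hC, hlt⟩ := h'
  have hfin : C.Finite := Set.finite_of_encard_le_coe hlt.le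
  refine ⟨hfin.toFinset, ?_, fun x hx => ?_⟩
  · rw [hfin.encard_eq_coe_toFinset_card] at hlt
    have : hfin.toFinset.card < m + 1 := by exact_mod_cast hlt
    omega
  · obtain ⟨y, hy, hxy⟩ := hC hx
    refine ⟨y, by simpa using hy, ?_⟩
    have hxy : edist x y ≤ r := hxy
    rw [edist_dist, ENNReal.ofReal_le_iff_le_toReal (by simp)] at hxy
    simpa using hxy

lemma coverNum_le_card {r : ℝ≥0} {A : Set X} (C : Finset X)
    (hC : ∀ x ∈ A, ∃ y ∈ C, dist x y ≤ r) : coverNum r A ≤ C.card := by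
  have h : Metric.IsCover r A (C : Set X) := by
    intro x hx
    obtain ⟨y, hy, hxy⟩ := hC x hx
    refine ⟨y, by simpa using hy, ?_⟩
    show edist x y ≤ r
    rw [edist_dist, ENNReal.ofReal_le_iff_le_toReal (by simp)]
    simpa using hxy
  have h' := h.externalCoveringNumber_le_encard
  rwa [Set.encard_coe_eq_coe_finsetCard] at h'

lemma coverNum_le_mul {r ρ : ℝ≥0} {A : Set X} {m n : ℕ} (hm : coverNum ρ A ≤ m)
    (hn : ∀ y : X, coverNum r (Metric.closedBall y ρ) ≤ n) : coverNum r A ≤ (m * n : ℕ) := by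
  classical
  obtain ⟨C, hCm, hC⟩ := exists_finset_cover_of_coverNum_le hm
  choose D hDn hD using fun y => exists_finset_cover_of_coverNum_le (hn y)
  refine (coverNum_le_card (C.biUnion D) fun x hx => ?_).trans ?_
  · obtain ⟨y, hy, hxy⟩ := hC x hx
    obtain ⟨z, hz, hxz⟩ := hD y x hxy
    exact ⟨z, Finset.mem_biUnion.2 ⟨y, hy, hz⟩, hxz⟩
  · have : (C.biUnion D).card ≤ m * n :=
      (Finset.card_biUnion_le_card_mul _ _ _ fun y _ => hDn y).trans
        (Nat.mul_le_mul_right _ hCm)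
    exact_mod_cast this

/-- One representative in `A` of each fibre of the code serves as a centre; centres thus lie in the
space itself. -/
lemma coverNum_le_of_code {ι : Type*} {r : ℝ≥0} {A : Set X} (c : X → ι) (S : Finset ι)
    (hS : ∀ x ∈ A, c x ∈ S) (hc : ∀ x ∈ A, ∀ y ∈ A, c x = c y → dist x y ≤ r) :
    coverNum r A ≤ S.card := by
  classical
  rcases A.eq_empty_or_nonempty with rfl | ⟨x₀, -⟩
  · simp [coverNum]
  have : ∀ i, ∃ y, (∃ x ∈ A, c x = i) → y ∈ A ∧ c y = i := fun i => by
    by_cases h : ∃ x ∈ A, c x = i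
    · obtain ⟨x, hx⟩ := h
      exact ⟨x, fun _ => hx⟩
    · exact ⟨x₀, fun h' => absurd h' h⟩
  choose s hs using this
  refine (coverNum_le_card (S.image s) fun x hx => ?_).trans
    (by exact_mod_cast Finset.card_image_le)
  have h := hs (c x) ⟨x, hx, rfl⟩
  exact ⟨s (c x), Finset.mem_image_of_mem _ (hS x hx), hc _ hx _ h.1 h.2.symm⟩

lemma exists_finset_separated_of_le_packNum {r : ℝ≥0} {A : Set X} {m : ℕ} (h : m ≤ packNum r A) :
    ∃ C : Finset X, C.card = m ∧ (∀ x ∈ C, x ∈ A) ∧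
      ∀ x ∈ C, ∀ y ∈ C, x ≠ y → 4 * (r : ℝ) < dist x y := by
  rcases m with _ | m
  · exact ⟨∅, by simp⟩
  have h' : (m : ℕ∞) < packNum r A :=
    lt_of_lt_of_le (by exact_mod_cast Nat.lt_succ_self m) h
  unfold packNum Metric.packingNumber at h'
  simp only [lt_iSup_iff] at h'
  obtain ⟨C, hCA, hC, hlt⟩ := h'
  have hle : ((m + 1 : ℕ) : ℕ∞) ≤ C.encard := by
    push_cast
    exact Order.add_one_le_of_lt hlt
  obtain ⟨D, hDC, hD⟩ := Set.exists_subset_encard_eq hle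
  have hfin : D.Finite := Set.finite_of_encard_eq_coe hD
  refine ⟨hfin.toFinset, ?_, fun x hx => hCA (hDC (by simpa using hx)), fun x hx y hy hxy => ?_⟩
  · rw [hfin.encard_eq_coe_toFinset_card] at hD
    exact_mod_cast hD
  · have : ((4 * r : ℝ≥0) : ℝ≥0∞) < edist x y :=
      hC (hDC (by simpa using hx)) (hDC (by simpa using hy)) hxy
    rw [edist_dist, ENNReal.lt_ofReal_iff_toReal_lt ENNReal.coe_ne_top] at this
    simpa using this

lemma card_le_packNum {r : ℝ≥0} {A : Set X} (C : Finset X) (hCA : ∀ x ∈ C, x ∈ A)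
    (hC : ∀ x ∈ C, ∀ y ∈ C, x ≠ y → 4 * (r : ℝ) < dist x y) : C.card ≤ packNum r A := by
  have h : Metric.IsSeparated ((4 * r : ℝ≥0) : ℝ≥0∞) (C : Set X) := by
    intro x hx y hy hxy
    show ((4 * r : ℝ≥0) : ℝ≥0∞) < edist x y
    rw [edist_dist, ENNReal.lt_ofReal_iff_toReal_lt ENNReal.coe_ne_top]
    simpa using hC x hx y hy hxy
  have h' := h.encard_le_packingNumber (A := A) hCA
  rwa [Set.encard_coe_eq_coe_finsetCard] at h'

/-- Place a fine packing in the `ρ`-ball about each point of a coarse one. Points from different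
balls are more than `4 ρ - 2 ρ = 2 ρ ≥ 4 r` apart; this is where the separation constant `4` enters.
-/
lemma mul_le_packNum {r ρ : ℝ≥0} {x : X} {R S : ℝ} {m n : ℕ} (hr : 2 * r ≤ ρ) (hS : R + ρ ≤ S)
    (hm : m ≤ packNum ρ (Metric.closedBall x R))
    (hn : ∀ y : X, n ≤ packNum r (Metric.closedBall y ρ)) :
    (m * n : ℕ) ≤ packNum r (Metric.closedBall x S) := by
  classical
  obtain ⟨C, hCm, hCA, hC⟩ := exists_finset_separated_of_le_packNum hm
  choose D hDn hDA hD using fun y => exists_finset_separated_of_le_packNum (hn y)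
  have hr' : 2 * (r : ℝ) ≤ ρ := by exact_mod_cast hr
  have hsep : ∀ y ∈ C, ∀ z ∈ C, y ≠ z → ∀ a ∈ D y, ∀ b ∈ D z, 4 * (r : ℝ) < dist a b := by
    intro y hy z hz hyz a ha b hb
    have h1 := hC y hy z hz hyz
    have h2 := Metric.mem_closedBall.1 (hDA y a ha)
    have h3 := Metric.mem_closedBall.1 (hDA z b hb)
    have h4 := dist_triangle4 y a b z
    rw [dist_comm y a] at h4
    linarith
  have hcard : (C.biUnion D).card = m * n := by
    rw [Finset.card_biUnion, Finset.sum_congr rfl fun y _ => hDn y, Finset.sum_const, hCm,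
      smul_eq_mul]
    intro y hy z hz hyz
    refine Finset.disjoint_left.2 fun a ha hb => ?_
    have := hsep y hy z hz hyz a ha a hb
    rw [dist_self] at this
    have : (0 : ℝ) ≤ r := r.2
    linarith
  rw [← hcard]
  refine card_le_packNum _ (fun a ha => ?_) fun a ha b hb hab => ?_
  · obtain ⟨y, hy, hay⟩ := Finset.mem_biUnion.1 ha
    have h1 := Metric.mem_closedBall.1 (hCA y hy)
    have h2 := Metric.mem_closedBall.1 (hDA y a hay)
    exact Metric.mem_closedBall.2 (by linarith [dist_triangle a y x])
  · obtain ⟨y, hy, hay⟩ := Finset.mem_biUnion.1 ha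
    obtain ⟨z, hz, hbz⟩ := Finset.mem_biUnion.1 hb
    rcases eq_or_ne y z with rfl | hyz
    · exact hD y a hay b hbz hab
    · exact hsep y hy z hz hyz a hay b hbz

lemma packNum_le_coverNum (r : ℝ≥0) (A : Set X) : packNum r A ≤ coverNum r A := by
  refine le_trans ?_ (Metric.packingNumber_two_mul_le_externalCoveringNumber r A)
  unfold packNum Metric.packingNumber
  refine iSup_mono fun C => iSup_mono fun _ => iSup_mono' fun h => ⟨h.anti ?_, le_rfl⟩
  rw [ENNReal.coe_le_coe]
  gcongr
  norm_num

variable (X) in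
/-- The supremal covering number of balls of radius `2 ^ (-v)` at scale `2 ^ (-u)`. -/
def supCover (u v : ℝ) : ℕ∞ :=
  ⨆ x : X, coverNum ((2 : ℝ≥0) ^ (-u)) (Metric.closedBall x ((2 : ℝ) ^ (-v)))

variable (X) in
/-- The infimal covering number of balls of radius `2 ^ (-v)` at scale `2 ^ (-u)`. -/
def infCover (u v : ℝ) : ℕ∞ :=
  ⨅ x : X, coverNum ((2 : ℝ≥0) ^ (-u)) (Metric.closedBall x ((2 : ℝ) ^ (-v)))

variable (X) in
/-- The infimal packing number of balls of radius `2 ^ (-v)` at scale `2 ^ (-u)`. -/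
def infPack (u v : ℝ) : ℕ∞ :=
  ⨅ x : X, packNum ((2 : ℝ≥0) ^ (-u)) (Metric.closedBall x ((2 : ℝ) ^ (-v)))

lemma coe_two_rpow (v : ℝ) : (((2 : ℝ≥0) ^ v : ℝ≥0) : ℝ) = (2 : ℝ) ^ v := by simp

lemma infPack_le_infCover (u v : ℝ) : infPack X u v ≤ infCover X u v :=
  iInf_mono fun _ => packNum_le_coverNum _ _

lemma infCover_le_supCover [Nonempty X] (u v : ℝ) : infCover X u v ≤ supCover X u v :=
  iInf_le_iSup

lemma infPack_ne_zero (u v : ℝ) : infPack X u v ≠ 0 := by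
  rw [← Order.one_le_iff_pos.trans pos_iff_ne_zero]
  refine le_iInf fun x => Order.one_le_iff_pos.2 ?_
  exact Metric.packingNumber_pos_iff.2 ⟨x, Metric.mem_closedBall_self (by positivity)⟩

lemma supCover_le_mul {u v w : ℝ} (h1 : supCover X v w ≠ ⊤) (h2 : supCover X u v ≠ ⊤) :
    supCover X u w ≤ supCover X v w * supCover X u v := by
  obtain ⟨m, hm⟩ := ENat.ne_top_iff_exists.1 h1
  obtain ⟨n, hn⟩ := ENat.ne_top_iff_exists.1 h2
  refine iSup_le fun x => ?_
  rw [← hm, ← hn, ← Nat.cast_mul]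
  refine coverNum_le_mul (ρ := 2 ^ (-v)) ?_ fun y => ?_
  · rw [hm]; exact le_iSup (fun x : X => coverNum _ (Metric.closedBall x _)) x
  · rw [hn, coe_two_rpow]; exact le_iSup (fun x : X => coverNum _ (Metric.closedBall x _)) y

/-- An infimum in `ℕ∞` is attained, so it is enough to refine an optimal cover of one minimizing
ball; only the second factor needs the supremum. -/
lemma infCover_le_mul [Nonempty X] {u v w : ℝ} (h1 : infCover X v w ≠ ⊤)
    (h2 : supCover X u v ≠ ⊤) : infCover X u w ≤ infCover X v w * supCover X u v := by
  obtain ⟨m, hm⟩ := ENat.ne_top_iff_exists.1 h1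
  obtain ⟨n, hn⟩ := ENat.ne_top_iff_exists.1 h2
  obtain ⟨x, hx⟩ := ciInf_mem
    (fun x : X => coverNum ((2 : ℝ≥0) ^ (-v)) (Metric.closedBall x ((2 : ℝ) ^ (-w))))
  refine (iInf_le _ x).trans ?_
  rw [← hm, ← hn, ← Nat.cast_mul]
  refine coverNum_le_mul (ρ := 2 ^ (-v)) ?_ fun y => ?_
  · rw [hm]; exact hx.le
  · rw [hn, coe_two_rpow]; exact le_iSup (fun x : X => coverNum _ (Metric.closedBall x _)) y

/-- The unit gaps in the exponents give the factors of `2` that `mul_le_packNum` requires: the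
`v`-balls must fit into the `w`-ball, and `2 * 2 ^ (-u) ≤ 2 ^ (-v)`. -/
lemma mul_le_infPack {u v w : ℝ} (hvw : w + 1 ≤ v) (huv : v + 1 ≤ u)
    (h1 : infPack X v (w + 1) ≠ ⊤) (h2 : infPack X u v ≠ ⊤) :
    infPack X v (w + 1) * infPack X u v ≤ infPack X u w := by
  obtain ⟨m, hm⟩ := ENat.ne_top_iff_exists.1 h1
  obtain ⟨n, hn⟩ := ENat.ne_top_iff_exists.1 h2
  refine le_iInf fun x => ?_
  rw [← hm, ← hn, ← Nat.cast_mul]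
  have key : ∀ a b : ℝ, b + 1 ≤ a → 2 * (2 : ℝ) ^ (-a) ≤ 2 ^ (-b) := fun a b hab => by
    calc 2 * (2 : ℝ) ^ (-a) = 2 ^ (1 + -a) := by
          rw [Real.rpow_add (by norm_num), Real.rpow_one]
      _ ≤ _ := Real.rpow_le_rpow_of_exponent_le (by norm_num) (by linarith)
  refine mul_le_packNum (ρ := 2 ^ (-v)) (R := 2 ^ (-(w + 1))) ?_ ?_ ?_ fun y => ?_
  · have := key u v huv
    rw [← NNReal.coe_le_coe]
    push_cast
    exact this
  · have h3 : (2 : ℝ) ^ (-v) ≤ 2 ^ (-(w + 1)) :=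
      Real.rpow_le_rpow_of_exponent_le (by norm_num) (by linarith)
    have h4 := key (w + 1) w le_rfl
    rw [coe_two_rpow]
    linarith
  · rw [hm]; exact iInf_le (fun x : X => packNum _ (Metric.closedBall x _)) x
  · rw [hn, coe_two_rpow]; exact iInf_le (fun x : X => packNum _ (Metric.closedBall x _)) y

end Metric

/-! ### Real logarithms of finite counts -/

section Log

/-- The real logarithm in base `2` of a finite element of `ℕ∞`. -/
def realLogTwo (n : ℕ∞) : ℝ := Real.logb 2 n.toNat

lemma realLogTwo_coe (n : ℕ) : realLogTwo n = Real.logb 2 n := rfl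

lemma realLogTwo_nonneg (n : ℕ∞) : 0 ≤ realLogTwo n := by
  unfold realLogTwo
  rcases Nat.eq_zero_or_pos n.toNat with h | h
  · simp [h]
  · exact Real.logb_nonneg (by norm_num) (by exact_mod_cast h)

lemma realLogTwo_le {m n : ℕ∞} (hm : m ≠ 0) (hn : n ≠ ⊤) (h : m ≤ n) :
    realLogTwo m ≤ realLogTwo n := by
  lift n to ℕ using hn
  lift m to ℕ using ne_top_of_le_ne_top (by simp) h
  have h0 : 0 < m := Nat.pos_of_ne_zero (by exact_mod_cast hm)
  have h' : m ≤ n := by exact_mod_cast h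
  exact Real.logb_le_logb_of_le (by norm_num) (by exact_mod_cast h0) (by exact_mod_cast h')

lemma realLogTwo_mul {m n : ℕ∞} (hm : m ≠ 0) (hn : n ≠ 0) (hm' : m ≠ ⊤) (hn' : n ≠ ⊤) :
    realLogTwo (m * n) = realLogTwo m + realLogTwo n := by
  lift n to ℕ using hn'
  lift m to ℕ using hm'
  rw [← Nat.cast_mul, realLogTwo_coe, realLogTwo_coe, realLogTwo_coe, Nat.cast_mul]
  exact Real.logb_mul (by exact_mod_cast hm) (by exact_mod_cast hn)

lemma realLogTwo_two_pow (n : ℕ) : realLogTwo ((2 ^ n : ℕ) : ℕ∞) = n := by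
  rw [realLogTwo_coe]
  push_cast
  rw [Real.logb_pow]
  simp

lemma logTwo_eq {n : ℕ∞} (hn : n ≠ 0) (hn' : n ≠ ⊤) : logTwo n = (realLogTwo n : EReal) := by
  lift n to ℕ using hn'
  have h0 : (0 : ℝ) < n := by exact_mod_cast Nat.pos_of_ne_zero (by exact_mod_cast hn)
  have h1 : ((n : ℕ∞) : ℝ≥0∞) = ENNReal.ofReal (n : ℝ) := by simp
  rw [logTwo, h1, ENNReal.log_ofReal_of_pos h0, realLogTwo_coe, Real.logb, EReal.coe_div]

lemma coe_eq_ofReal_two_rpow {n : ℕ∞} (hn : n ≠ 0) (hn' : n ≠ ⊤) :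
    (n : ℝ≥0∞) = ENNReal.ofReal (2 ^ realLogTwo n) := by
  lift n to ℕ using hn'
  have h0 : (0 : ℝ) < n := by exact_mod_cast Nat.pos_of_ne_zero (by exact_mod_cast hn)
  rw [realLogTwo_coe, Real.rpow_logb (by norm_num) (by norm_num) h0]
  simp

end Log

section Uniform

variable {X : Type*} [MetricSpace X] [Nonempty X]

/-- Once all counts are finite and nonzero, the extended-real logarithms are real and the default
value of `realLogTwo` at `⊤` never occurs. -/
lemma isUniformWith_iff {η : ℝ → ℝ} (hfin : ∀ u v : ℝ, v ≤ u → supCover X u v ≠ ⊤) :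
    IsUniformWith X η ↔ Tendsto (fun u => u⁻¹ * η u) atTop (𝓝 0) ∧
      ∀ u v : ℝ, v ≤ u → realLogTwo (supCover X u v) ≤ realLogTwo (infPack X u v) + η u := by
  refine and_congr_right fun _ => forall_congr' fun u => forall_congr' fun v =>
    forall_congr' fun huv => ?_
  have hP := infPack_ne_zero (X := X) u v
  have hPS := (infPack_le_infCover (X := X) u v).trans (infCover_le_supCover u v)
  have h1 : upperBranching X u v = realLogTwo (supCover X u v) :=
    logTwo_eq (ne_bot_of_le_ne_bot hP hPS) (hfin u v huv)
  have h2 : lowerBranching X u v = realLogTwo (infPack X u v) :=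
    logTwo_eq hP (ne_top_of_le_ne_top (hfin u v huv) hPS)
  rw [h1, h2, ← EReal.coe_add, EReal.coe_le_coe_iff]

end Uniform

/-! ### The covering bound in Euclidean space -/

section Euclidean

variable {d : ℕ}

lemma EuclideanSpace.dist_le_two_pow_mul {x y : EuclideanSpace ℝ (Fin d)} {δ : ℝ} (hδ : 0 ≤ δ)
    (h : ∀ i, |x i - y i| ≤ δ) : dist x y ≤ 2 ^ d * δ := by
  rw [EuclideanSpace.dist_eq]
  refine Real.sqrt_le_iff.2 ⟨by positivity, ?_⟩
  calc ∑ i, dist (x i) (y i) ^ 2 ≤ ∑ _i : Fin d, δ ^ 2 := by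
        gcongr with i
        exact h i
    _ = d * δ ^ 2 := by simp
    _ ≤ (2 ^ d) ^ 2 * δ ^ 2 := by
        gcongr
        have h1 : (d : ℝ) ≤ 2 ^ d := by exact_mod_cast Nat.lt_two_pow_self.le
        have h2 : (1 : ℝ) ≤ 2 ^ d := one_le_pow₀ (by norm_num)
        nlinarith
    _ = _ := by ring

lemma EuclideanSpace.abs_sub_le_dist (x y : EuclideanSpace ℝ (Fin d)) (i : Fin d) :
    |x i - y i| ≤ dist x y := by
  rw [EuclideanSpace.dist_eq]
  refine Real.le_sqrt_of_sq_le ?_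
  rw [← Real.dist_eq]
  exact Finset.single_le_sum (f := fun i => dist (x i) (y i) ^ 2) (fun _ _ => sq_nonneg _)
    (Finset.mem_univ i)

lemma Int.card_Icc_le {a b c : ℝ} (hb : b - a ≤ c) (hc : 0 ≤ c) :
    ((Finset.Icc ⌊a⌋ ⌊b⌋).card : ℝ) ≤ c + 2 := by
  rw [Int.card_Icc]
  have h1 := Int.floor_le b
  have h2 := Int.lt_floor_add_one a
  rcases le_total 0 (⌊b⌋ + 1 - ⌊a⌋) with h | h
  · have : (((⌊b⌋ + 1 - ⌊a⌋).toNat : ℤ) : ℝ) = ((⌊b⌋ + 1 - ⌊a⌋ : ℤ) : ℝ) := by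
      rw [Int.toNat_of_nonneg h]
    rw [Int.cast_natCast] at this
    rw [this]; push_cast; linarith
  · rw [Int.toNat_of_nonpos h]; simp; linarith

lemma exists_supCover_le (d : ℕ) : ∃ K : ℝ, ∀ F : Set (EuclideanSpace ℝ (Fin d)),
    F.Nonempty → ∀ u v : ℝ, v ≤ u →
      supCover F u v ≠ ⊤ ∧ realLogTwo (supCover F u v) ≤ K + d * (u - v) := by
  -- Points are coded by their cell in a grid of mesh `2 ^ (-(u + d))`, as cell diameters lose a
  -- factor at most `2 ^ d`. Each coordinate meets at most `2 * 2 ^ (u - v + d) + 2 ≤ 2 ^ (u - v + d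
  -- + 2)` cells.
  refine ⟨d * (d + 2), fun F hF u v huv => ?_⟩
  have : Nonempty F := hF.to_subtype
  set t : ℝ := 2 ^ (u + d) with ht
  have ht0 : 0 < t := by positivity
  set N : ℕ := ⌊(2 : ℝ) ^ (u - v + (d + 2))⌋₊ with hN
  have hpow : (1 : ℝ) ≤ 2 ^ (u - v + d) :=
    Real.one_le_rpow (by norm_num) (by have : (0 : ℝ) ≤ d := by positivity
                                       linarith)
  have key : supCover F u v ≤ (N ^ d : ℕ) := by
    refine iSup_le fun x => ?_
    set S : Finset (Fin d → ℤ) := Fintype.piFinset fun i =>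
      Finset.Icc ⌊t * (x.1 i - 2 ^ (-v))⌋ ⌊t * (x.1 i + 2 ^ (-v))⌋
    refine (coverNum_le_of_code (fun y : F => fun i => ⌊t * y.1 i⌋) S
      (fun y hy => ?_) fun y _ z _ hyz => ?_).trans ?_
    · refine Fintype.mem_piFinset.2 fun i => Finset.mem_Icc.2 ?_
      have h1 := (EuclideanSpace.abs_sub_le_dist y.1 x.1 i).trans (Metric.mem_closedBall.1 hy)
      rw [abs_le] at h1
      constructor <;> refine Int.floor_le_floor (mul_le_mul_of_nonneg_left ?_ ht0.le) <;> linarith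
    · have h1 : ∀ i, |y.1 i - z.1 i| ≤ t⁻¹ := fun i => by
        have h2 : |t * y.1 i - t * z.1 i| < 1 := Int.abs_sub_lt_one_of_floor_eq_floor
          (congrFun hyz i)
        rw [← mul_sub, abs_mul, abs_of_pos ht0] at h2
        rw [inv_eq_one_div, le_div_iff₀ ht0]
        linarith
      refine (EuclideanSpace.dist_le_two_pow_mul (inv_nonneg.2 ht0.le) h1).trans (le_of_eq ?_)
      rw [coe_two_rpow, ht, ← Real.rpow_neg (by norm_num), ← Real.rpow_natCast,
        ← Real.rpow_add (by norm_num)]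
      congr 1; ring
    · have h1 : S.card ≤ N ^ d := by
        rw [Fintype.card_piFinset]
        refine (Finset.prod_le_pow_card _ _ N fun i _ => ?_).trans (by simp)
        refine Nat.le_floor ((Int.card_Icc_le (c := 2 * 2 ^ (u - v + d)) (le_of_eq ?_)
          (by positivity)).trans ?_)
        · have : (2 : ℝ) ^ (u - v + d) = t * 2 ^ (-v) := by
            rw [ht, ← Real.rpow_add (by norm_num)]; congr 1; ring
          rw [this]; ring
        · have : (2 : ℝ) ^ (u - v + (d + 2)) = 4 * 2 ^ (u - v + d) := by
            rw [← add_assoc, Real.rpow_add (by norm_num)]; norm_num; ring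
          rw [this]; linarith
      exact_mod_cast h1
  have hfin : supCover F u v ≠ ⊤ := ne_top_of_le_ne_top (ENat.natCast_ne_top _) key
  refine ⟨hfin, ?_⟩
  have h0 : supCover F u v ≠ 0 := ne_bot_of_le_ne_bot (infPack_ne_zero (X := F) u v)
    ((infPack_le_infCover (X := F) u v).trans (infCover_le_supCover u v))
  refine (realLogTwo_le h0 (ENat.natCast_ne_top _) key).trans ?_
  rw [realLogTwo_coe, Nat.cast_pow, Real.logb_pow]
  have h1 : Real.logb 2 N ≤ u - v + (d + 2) := by
    have hN0 : (0 : ℝ) < N := by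
      have : 0 < N := Nat.floor_pos.2 (Real.one_le_rpow (by norm_num)
        (by have : (0 : ℝ) ≤ d := by positivity
            linarith))
      exact_mod_cast this
    rw [Real.logb_le_iff_le_rpow (by norm_num) hN0]
    exact Nat.floor_le (by positivity)
  have := mul_le_mul_of_nonneg_left h1 (Nat.cast_nonneg (α := ℝ) d)
  linarith

end Euclidean

/-! ### Scaled lower limits -/

/-- `liminf A(u) / u = p` as `u → ∞`. -/
def HasScaledLiminf (A : ℝ → ℝ) (p : ℝ) : Prop :=
  (∀ ε > 0, ∀ᶠ u in atTop, (p - ε) * u ≤ A u) ∧ ∀ ε > 0, ∃ᶠ u in atTop, A u ≤ (p + ε) * u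

lemma HasScaledLiminf.ge_of_eventually {A : ℝ → ℝ} {p q : ℝ} (h : HasScaledLiminf A p)
    (hq : ∀ ε > 0, ∀ᶠ u in atTop, (q - ε) * u ≤ A u) : q ≤ p := by
  refine le_of_forall_pos_le_add fun ε hε => ?_
  obtain ⟨u, h1, h2, h3⟩ := ((h.2 (ε / 2) (by positivity)).and_eventually
    ((hq (ε / 2) (by positivity)).and (eventually_gt_atTop 0))).exists
  have := le_of_mul_le_mul_right (h2.trans h1) h3
  linarith

lemma HasScaledLiminf.le_of_eventually_le {A B : ℝ → ℝ} {p q : ℝ} (hA : HasScaledLiminf A p)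
    (hB : HasScaledLiminf B q) (h : ∀ ε > 0, ∀ᶠ u in atTop, A u ≤ B u + ε * u) : p ≤ q := by
  refine hB.ge_of_eventually fun ε hε => ?_
  filter_upwards [hA.1 (ε / 2) (by positivity), h (ε / 2) (by positivity)] with u h1 h2
  linarith

lemma eventually_const_le_mul (K : ℝ) {ε : ℝ} (hε : 0 < ε) : ∀ᶠ u : ℝ in atTop, K ≤ ε * u :=
  (tendsto_id.const_mul_atTop hε).eventually_ge_atTop K

lemma eventually_le_mul_of_tendsto {η : ℝ → ℝ} (hη : Tendsto (fun u => u⁻¹ * η u) atTop (𝓝 0))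
    {ε : ℝ} (hε : 0 < ε) : ∀ᶠ u : ℝ in atTop, η u ≤ ε * u := by
  filter_upwards [hη.eventually (eventually_le_nhds hε), eventually_gt_atTop 0] with u h1 h2
  rwa [inv_mul_le_iff₀ h2, mul_comm] at h1

/-! ### The lower spectrum as a lower limit -/

section Spectrum

variable {X : Type*} [MetricSpace X]

lemma iInf_coverNum_two_rpow (θ u : ℝ) :
    (⨅ x : X, coverNum ((2 : ℝ≥0) ^ (-u))
      (Metric.closedBall x ((((2 : ℝ≥0) ^ (-u) : ℝ≥0) : ℝ) ^ θ))) = infCover X u (θ * u) := by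
  have : (((2 : ℝ≥0) ^ (-u) : ℝ≥0) : ℝ) ^ θ = (2 : ℝ) ^ (-(θ * u)) := by
    rw [coe_two_rpow, ← Real.rpow_mul (by norm_num)]; congr 1; ring
  rw [this]; rfl

lemma exists_const_le_iInf_coverNum_iff [Nonempty X] {θ : ℝ} (hθ : θ ∈ Ioo (0 : ℝ) 1)
    (hfin : ∀ u v : ℝ, v ≤ u → infCover X u v ≠ ⊤) (s : ℝ≥0) :
    (∃ C : ℝ, 0 < C ∧ ∀ r : ℝ≥0, 0 < r → r < 1 →
      ENNReal.ofReal (C * ((r : ℝ) ^ θ / (r : ℝ)) ^ (s : ℝ)) ≤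
        ((⨅ x : X, coverNum r (Metric.closedBall x ((r : ℝ) ^ θ)) : ℕ∞) : ℝ≥0∞)) ↔
    ∃ K : ℝ, ∀ u > 0, (1 - θ) * s * u - K ≤ realLogTwo (infCover X u (θ * u)) := by
  have key : ∀ u > 0, ∀ K : ℝ, ENNReal.ofReal (2 ^ (-K) *
      ((((2 : ℝ≥0) ^ (-u) : ℝ≥0) : ℝ) ^ θ / (((2 : ℝ≥0) ^ (-u) : ℝ≥0) : ℝ)) ^ (s : ℝ)) ≤
        ((⨅ x : X, coverNum ((2 : ℝ≥0) ^ (-u)) (Metric.closedBall x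
          ((((2 : ℝ≥0) ^ (-u) : ℝ≥0) : ℝ) ^ θ)) : ℕ∞) : ℝ≥0∞) ↔
      (1 - θ) * s * u - K ≤ realLogTwo (infCover X u (θ * u)) := by
    intro u hu K
    rw [iInf_coverNum_two_rpow, coe_eq_ofReal_two_rpow
      (ne_bot_of_le_ne_bot (infPack_ne_zero _ _) (infPack_le_infCover _ _))
      (hfin _ _ (by nlinarith [hθ.2])), ENNReal.ofReal_le_ofReal_iff (by positivity),
      coe_two_rpow, ← Real.rpow_mul (by norm_num), ← Real.rpow_sub (by norm_num),
      ← Real.rpow_mul (by norm_num), ← Real.rpow_add (by norm_num),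
      Real.rpow_le_rpow_left_iff (by norm_num)]
    have : -K + (-u * θ - -u) * s = (1 - θ) * s * u - K := by ring
    rw [this]
  constructor
  · rintro ⟨C, hC, h⟩
    refine ⟨-Real.logb 2 C, fun u hu => (key u hu _).1 ?_⟩
    rw [neg_neg, Real.rpow_logb (by norm_num) (by norm_num) hC]
    exact h _ (NNReal.rpow_pos (by norm_num))
      (NNReal.rpow_lt_one_of_one_lt_of_neg (by norm_num) (by linarith))
  · rintro ⟨K, h⟩
    refine ⟨2 ^ (-K), by positivity, fun r hr0 hr1 => ?_⟩
    have hr0' : (0 : ℝ) < r := by exact_mod_cast hr0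
    have e : r = (2 : ℝ≥0) ^ (-(-Real.logb 2 r)) := by
      rw [← NNReal.coe_inj, coe_two_rpow, neg_neg, Real.rpow_logb (by norm_num) (by norm_num) hr0']
    have hu : 0 < -Real.logb 2 r := by
      have := Real.logb_neg (b := 2) (by norm_num) hr0' (by exact_mod_cast hr1)
      linarith
    have := (key _ hu K).2 (h _ hu)
    rwa [← e] at this

/-- With `r = 2 ^ (-u)`, the constant `C` becomes an additive `K`, negligible against `ε * u`.
Conversely a linear lower bound for large `u` holds for all `u > 0` after subtracting a constant,
because the logarithms are nonnegative (`hmem`). -/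
lemma ofReal_mul_lowerSpectrum_eq_iff [Nonempty X] {θ p : ℝ} (hθ : θ ∈ Ioo (0 : ℝ) 1)
    (hp : 0 ≤ p) (hfin : ∀ u v : ℝ, v ≤ u → infCover X u v ≠ ⊤) :
    ENNReal.ofReal (1 - θ) * lowerSpectrum θ X = ENNReal.ofReal p ↔
      HasScaledLiminf (fun u => realLogTwo (infCover X u (θ * u))) p := by
  have hθ' : 0 < 1 - θ := by linarith [hθ.2]
  set A : ℝ → ℝ := fun u => realLogTwo (infCover X u (θ * u)) with hA
  have hA0 : ∀ u, 0 ≤ A u := fun u => realLogTwo_nonneg _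
  set S : Set ℝ≥0 := {s : ℝ≥0 | ∃ K : ℝ, ∀ u > 0, (1 - θ) * s * u - K ≤ A u} with hS
  have hL : lowerSpectrum θ X = ⨆ s ∈ S, (s : ℝ≥0∞) := by
    unfold lowerSpectrum
    simp only [exists_const_le_iInf_coverNum_iff hθ hfin]
    rfl
  have hmul : ENNReal.ofReal (1 - θ) * lowerSpectrum θ X = ENNReal.ofReal p ↔
      lowerSpectrum θ X = ENNReal.ofReal (p / (1 - θ)) := by
    rw [ENNReal.ofReal_div_of_pos hθ',
      ENNReal.eq_div_iff (ENNReal.ofReal_pos.2 hθ').ne' ENNReal.ofReal_ne_top]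
  have hmem : ∀ q : ℝ, ∀ s : ℝ≥0, (s : ℝ) = q / (1 - θ) → ∀ U : ℝ,
      (∀ u ≥ U, q * u ≤ A u) → s ∈ S := by
    intro q s hs U hU
    have hq : (1 - θ) * s = q := by rw [hs]; field_simp
    have hq0 : 0 ≤ q := by rw [← hq]; positivity
    refine ⟨q * |U|, fun u hu => ?_⟩
    rw [hq]
    rcases le_total U u with h | h
    · have := hU u h
      have : 0 ≤ q * |U| := by positivity
      linarith
    · have := mul_le_mul_of_nonneg_left (h.trans (le_abs_self U)) hq0
      linarith [hA0 u]
  rw [hmul, hL]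
  constructor
  · intro h
    constructor
    · intro ε hε
      rcases le_or_gt (p - ε) 0 with h0 | h0
      · filter_upwards [eventually_ge_atTop 0] with u hu
        exact (mul_nonpos_of_nonpos_of_nonneg h0 hu).trans (hA0 u)
      · have h1 : ENNReal.ofReal ((p - ε / 2) / (1 - θ)) < ⨆ s ∈ S, (s : ℝ≥0∞) := by
          rw [h, ENNReal.ofReal_lt_ofReal_iff (div_pos (by linarith) hθ')]
          gcongr; linarith
        simp only [lt_iSup_iff] at h1
        obtain ⟨s, ⟨K, hK⟩, hlt⟩ := h1
        rw [← ENNReal.ofReal_coe_nnreal, ENNReal.ofReal_lt_ofReal_iff_of_nonneg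
          (div_nonneg (by linarith) hθ'.le), div_lt_iff₀ hθ'] at hlt
        filter_upwards [eventually_gt_atTop 0, eventually_const_le_mul K (half_pos hε)]
          with u hu hu'
        have := hK u hu
        have := mul_le_mul_of_nonneg_right hlt.le hu.le
        linarith
    · intro ε hε hcon
      obtain ⟨U, hU⟩ := eventually_atTop.1 hcon
      obtain ⟨s, hs⟩ : ∃ s : ℝ≥0, (s : ℝ) = (p + ε) / (1 - θ) :=
        ⟨Real.toNNReal _, Real.coe_toNNReal _ (by positivity)⟩
      have h1 := hmem (p + ε) s hs U
        fun u hu => (not_le.1 (hU u hu)).le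
      have h2 := le_iSup₂ (f := fun (s : ℝ≥0) (_ : s ∈ S) => (s : ℝ≥0∞)) _ h1
      rw [h, ← ENNReal.ofReal_coe_nnreal, ENNReal.ofReal_le_ofReal_iff (by positivity), hs] at h2
      have : p / (1 - θ) < (p + ε) / (1 - θ) := by gcongr; linarith
      exact absurd h2 (not_le.2 this)
  · intro h
    refine le_antisymm (iSup₂_le ?_) (le_of_forall_lt fun c hc => ?_)
    · rintro s ⟨K, hK⟩
      rw [← ENNReal.ofReal_coe_nnreal]
      refine ENNReal.ofReal_le_ofReal ((le_div_iff₀ hθ').2 ?_)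
      rw [mul_comm]
      refine h.ge_of_eventually fun ε hε => ?_
      filter_upwards [eventually_gt_atTop 0, eventually_const_le_mul K hε] with u hu hu'
      have := hK u hu
      linarith
    · lift c to ℝ≥0 using hc.ne_top
      rw [← ENNReal.ofReal_coe_nnreal] at hc
      replace hc : (c : ℝ) * (1 - θ) < p :=
        (lt_div_iff₀ hθ').1 ((ENNReal.ofReal_lt_ofReal_iff_of_nonneg c.coe_nonneg).1 hc)
      set q := (c * (1 - θ) + p) / 2 with hq
      have hq0 : 0 ≤ q := by positivity
      obtain ⟨U, hU⟩ := eventually_atTop.1 (h.1 (p - q) (by linarith))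
      obtain ⟨s, hs⟩ : ∃ s : ℝ≥0, (s : ℝ) = q / (1 - θ) :=
        ⟨Real.toNNReal _, Real.coe_toNNReal _ (by positivity)⟩
      have h1 := hmem q s hs U
        fun u hu => by have := hU u hu; rwa [sub_sub_cancel] at this
      refine lt_of_lt_of_le ?_ (le_iSup₂ (f := fun (s : ℝ≥0) (_ : s ∈ S) => (s : ℝ≥0∞)) _ h1)
      rw [ENNReal.coe_lt_coe, ← NNReal.coe_lt_coe, hs, lt_div_iff₀ hθ']
      linarith

end Spectrum

/-! ### Necessity of the two conditions -/

section Necessity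

/-- Here `P ≤ A ≤ S` stand for the logarithms of `infPack`, `infCover` and `supCover`. Uniformity,
`S ≤ P + η`, allows each to replace the others, so the superadditivity of `P` and the subadditivity
of `S` both pass to the liminf of `A`. -/
lemma lipschitzOn_and_superadd_of_hasScaledLiminf {A S P : ℝ → ℝ → ℝ} {η φ : ℝ → ℝ} {K : ℝ}
    {d : ℕ} (hη : Tendsto (fun u => u⁻¹ * η u) atTop (𝓝 0))
    (hPA : ∀ u v, v ≤ u → P u v ≤ A u v) (hAS : ∀ u v, v ≤ u → A u v ≤ S u v)
    (hS : ∀ u v, v ≤ u → S u v ≤ K + d * (u - v)) (hSP : ∀ u v, v ≤ u → S u v ≤ P u v + η u)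
    (hSS : ∀ u v w, w ≤ v → v ≤ u → S u w ≤ S v w + S u v)
    (hAA : ∀ u v w, w ≤ v → v ≤ u → A u w ≤ A v w + S u v)
    (hPP : ∀ u v w, w + 1 ≤ v → v + 1 ≤ u → P v (w + 1) + P u v ≤ P u w)
    (h0 : MapsTo φ (Ioc 0 1) (Icc 0 (d : ℝ)))
    (hφ : ∀ θ ∈ Ioo (0 : ℝ) 1, HasScaledLiminf (fun u => A u (θ * u)) (φ θ))
    (h1 : Tendsto (fun θ => ENNReal.ofReal (φ θ)) (𝓝[<] 1) (𝓝 (ENNReal.ofReal (φ 1)))) :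
    LipschitzOnWith (d : ℝ≥0) φ (Ioc 0 1) ∧
      ∀ l ∈ Ioc (0 : ℝ) 1, ∀ θ ∈ Ioc (0 : ℝ) 1, φ θ ≤ φ (l * θ) - θ * φ l := by
  have hle : ∀ θ ∈ Ioo (0 : ℝ) 1, φ θ ≤ d * (1 - θ) := by
    intro θ hθ
    refine (hφ θ hθ).le_of_eventually_le (B := fun u => d * (1 - θ) * u) ⟨?_, ?_⟩ ?_
    · intro ε hε
      filter_upwards [eventually_ge_atTop 0] with u hu
      nlinarith
    · intro ε hε
      refine Eventually.frequently ?_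
      filter_upwards [eventually_ge_atTop 0] with u hu
      nlinarith
    · intro ε hε
      filter_upwards [eventually_ge_atTop 0, eventually_const_le_mul K hε] with u hu hu'
      have h2 : θ * u ≤ u := mul_le_of_le_one_left hu hθ.2.le
      have := (hAS _ _ h2).trans (hS _ _ h2)
      linarith
  -- The value at `1` is prescribed as a limit, and `φ θ ≤ d * (1 - θ)` forces it to vanish.
  have hone : φ 1 = 0 := by
    have h2 : Tendsto (fun θ : ℝ => ENNReal.ofReal (d * (1 - θ))) (𝓝[<] 1)
        (𝓝 (ENNReal.ofReal (d * (1 - 1)))) := by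
      refine (ENNReal.continuous_ofReal.tendsto _).comp ?_
      exact ((continuous_const.mul (continuous_const.sub continuous_id)).tendsto (1 : ℝ)).mono_left
        nhdsWithin_le_nhds
    have h3 := le_of_tendsto_of_tendsto h1 h2 (by
      filter_upwards [Ioo_mem_nhdsLT (show (0 : ℝ) < 1 by norm_num)] with θ hθ
      exact ENNReal.ofReal_le_ofReal (hle θ hθ))
    rw [sub_self, mul_zero, ENNReal.ofReal_zero, nonpos_iff_eq_zero, ENNReal.ofReal_eq_zero] at h3
    exact le_antisymm h3 (h0 (by simp)).1
  have hsuper : ∀ l ∈ Ioc (0 : ℝ) 1, ∀ θ ∈ Ioc (0 : ℝ) 1, φ θ ≤ φ (l * θ) - θ * φ l := by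
    intro l hl θ hθ
    rcases hl.2.eq_or_lt with rfl | hl1
    · simp [hone]
    rcases hθ.2.eq_or_lt with rfl | hθ1
    · simp [hone]
    have hlθ : l * θ ∈ Ioo (0 : ℝ) 1 :=
      ⟨mul_pos hl.1 hθ.1, by nlinarith [hl.1, hθ.1]⟩
    -- Superadditivity of `P` is used at `u`, `θ * u`, `l * θ * u`. The five errors `ε / 5` are the
    -- two liminf errors, `η` at `u` and at `θ * u`, and `K + d` for the unit shift of `l * θ * u`.
    rw [le_sub_iff_add_le]
    refine (hφ _ hlθ).ge_of_eventually fun ε hε => ?_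
    have hε' : 0 < ε / 5 := by positivity
    have ht : Tendsto (fun u : ℝ => θ * u) atTop atTop := tendsto_id.const_mul_atTop hθ.1
    filter_upwards [eventually_gt_atTop 0, (hφ θ ⟨hθ.1, hθ1⟩).1 _ hε',
      ht.eventually ((hφ l ⟨hl.1, hl1⟩).1 _ hε'), eventually_le_mul_of_tendsto hη hε',
      ht.eventually (eventually_le_mul_of_tendsto hη hε'), eventually_const_le_mul (K + d) hε',
      eventually_const_le_mul 1 (show 0 < 1 - θ by linarith),
      eventually_const_le_mul 1 (show 0 < θ * (1 - l) from mul_pos hθ.1 (by linarith))]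
      with u hu a1 a2 a3 a4 a5 a6 a7
    have e : l * (θ * u) = l * θ * u := by ring
    rw [e] at a2
    have b1 : θ * u + 1 ≤ u := by linarith
    have b2 : l * θ * u + 1 ≤ θ * u := by linarith
    have c1 := hPA u (l * θ * u) (by linarith)
    have c2 := hPP u (θ * u) (l * θ * u) b2 b1
    have c3 := hSP (θ * u) (l * θ * u + 1) b2
    have c4 := hSP u (θ * u) (by linarith)
    have c5 := hSS (θ * u) (l * θ * u + 1) (l * θ * u) (by linarith) b2
    have c6 := hS (l * θ * u + 1) (l * θ * u) (by linarith)
    have c7 := hAS u (θ * u) (by linarith)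
    have c8 := hAS (θ * u) (l * θ * u) (by linarith)
    have c9 : ε / 5 * (θ * u) ≤ ε / 5 * u := by gcongr; linarith
    have c10 : (d : ℝ) * (l * θ * u + 1 - l * θ * u) = d := by ring
    rw [c10] at c6
    linarith
  refine ⟨LipschitzOnWith.of_le_add_mul _ fun x hx y hy => ?_, hsuper⟩
  have hpos : (0 : ℝ) ≤ (d : ℝ≥0) * dist x y := by positivity
  -- For `y ≤ x` the functional inequality with `l = y / x` already gives `φ x ≤ φ y`; only the
  -- other direction uses covers.
  rcases le_total y x with h | h
  · have h2 := hsuper (y / x) ⟨div_pos hy.1 hx.1, (div_le_one hx.1).2 h⟩ x hx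
    rw [div_mul_cancel₀ _ hx.1.ne'] at h2
    have := mul_nonneg hx.1.le (h0 ⟨div_pos hy.1 hx.1, (div_le_one hx.1).2 h⟩).1
    linarith
  rw [Real.dist_eq, abs_sub_comm, abs_of_nonneg (sub_nonneg.2 h)]
  simp only [NNReal.coe_natCast]
  rcases h.eq_or_lt with rfl | hlt
  · simp
  rcases hy.2.eq_or_lt with rfl | hy1
  · rw [hone, zero_add]
    exact hle x ⟨hx.1, hlt⟩
  rw [← sub_le_iff_le_add]
  refine (hφ y ⟨hy.1, hy1⟩).ge_of_eventually fun ε hε => ?_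
  filter_upwards [eventually_gt_atTop 0, (hφ x ⟨hx.1, hlt.trans hy1⟩).1 _ (half_pos hε),
    eventually_const_le_mul K (show 0 < ε / 4 by positivity),
    eventually_le_mul_of_tendsto hη (show 0 < ε / 4 by positivity)] with u hu a1 a2 a3
  have b1 : x * u ≤ y * u := by gcongr
  have b2 : y * u ≤ u := mul_le_of_le_one_left hu.le hy.2
  have c1 := hAA u (y * u) (x * u) b1 b2
  have c2 := hAS (y * u) (x * u) b1
  have c3 := hS (y * u) (x * u) b1
  have c4 := hSP u (y * u) b2
  have c5 := hPA u (y * u) b2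
  linarith

lemma lipschitzOn_and_superadd_of_isUniform {d : ℕ} {F : Set (EuclideanSpace ℝ (Fin d))}
    (hF : F.Nonempty) (hunif : IsUniformSpaceAtScales F) {φ : ℝ → ℝ}
    (h0 : MapsTo φ (Ioc 0 1) (Icc 0 (d : ℝ))) (hφ : HasScaledLowerSpectrum F φ) :
    LipschitzOnWith (d : ℝ≥0) φ (Ioc 0 1) ∧
      ∀ l ∈ Ioc (0 : ℝ) 1, ∀ θ ∈ Ioc (0 : ℝ) 1, φ θ ≤ φ (l * θ) - θ * φ l := by
  have : Nonempty F := hF.to_subtype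
  obtain ⟨K, hK⟩ := exists_supCover_le d
  have hS : ∀ u v : ℝ, v ≤ u → supCover F u v ≠ ⊤ := fun u v h => (hK F hF u v h).1
  have hA : ∀ u v : ℝ, v ≤ u → infCover F u v ≠ ⊤ := fun u v h =>
    ne_top_of_le_ne_top (hS u v h) (infCover_le_supCover u v)
  have hP : ∀ u v : ℝ, v ≤ u → infPack F u v ≠ ⊤ := fun u v h =>
    ne_top_of_le_ne_top (hA u v h) (infPack_le_infCover u v)
  have hA0 : ∀ u v : ℝ, infCover F u v ≠ 0 := fun u v =>
    ne_bot_of_le_ne_bot (infPack_ne_zero u v) (infPack_le_infCover u v)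
  have hS0 : ∀ u v : ℝ, supCover F u v ≠ 0 := fun u v =>
    ne_bot_of_le_ne_bot (hA0 u v) (infCover_le_supCover u v)
  obtain ⟨η, hη⟩ := hunif
  rw [isUniformWith_iff hS] at hη
  refine lipschitzOn_and_superadd_of_hasScaledLiminf
    (A := fun u v => realLogTwo (infCover F u v)) (S := fun u v => realLogTwo (supCover F u v))
    (P := fun u v => realLogTwo (infPack F u v)) hη.1
    (fun u v h => realLogTwo_le (infPack_ne_zero u v) (hA u v h) (infPack_le_infCover u v))
    (fun u v h => realLogTwo_le (hA0 u v) (hS u v h) (infCover_le_supCover u v))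
    (fun u v h => (hK F hF u v h).2) hη.2 (fun u v w hwv hvu => ?_) (fun u v w hwv hvu => ?_)
    (fun u v w hwv hvu => ?_) h0 (fun θ hθ => ?_) ?_
  · rw [← realLogTwo_mul (hS0 _ _) (hS0 _ _) (hS _ _ hwv) (hS _ _ hvu)]
    exact realLogTwo_le (hS0 _ _) (WithTop.mul_ne_top (hS _ _ hwv) (hS _ _ hvu))
      (supCover_le_mul (hS _ _ hwv) (hS _ _ hvu))
  · rw [← realLogTwo_mul (hA0 _ _) (hS0 _ _) (hA _ _ hwv) (hS _ _ hvu)]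
    exact realLogTwo_le (hA0 _ _) (WithTop.mul_ne_top (hA _ _ hwv) (hS _ _ hvu))
      (infCover_le_mul (hA _ _ hwv) (hS _ _ hvu))
  · have hvu' : v ≤ u := by linarith
    rw [← realLogTwo_mul (infPack_ne_zero _ _) (infPack_ne_zero _ _) (hP _ _ hwv) (hP _ _ hvu')]
    exact realLogTwo_le (mul_ne_zero (infPack_ne_zero _ _) (infPack_ne_zero _ _))
      (hP _ _ (by linarith)) (mul_le_infPack hwv hvu (hP _ _ hwv) (hP _ _ hvu'))
  · exact (ofReal_mul_lowerSpectrum_eq_iff hθ (h0 ⟨hθ.1, hθ.2.le⟩).1 hA).1 (hφ.1 θ hθ)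
  · refine hφ.2.congr' ?_
    filter_upwards [Ioo_mem_nhdsLT (show (0 : ℝ) < 1 by norm_num)] with θ hθ
    exact hφ.1 θ hθ

end Necessity

/-! ### Binary expansions and distances -/

section Digits

/-- The integer whose binary digits are the first `k` terms of `x`. -/
def digitPrefix (x : ℕ → Fin 2) : ℕ → ℕ
  | 0 => 0
  | k + 1 => 2 * digitPrefix x k + x k

lemma digitPrefix_inj {x y : ℕ → Fin 2} {k : ℕ} (h : digitPrefix x k = digitPrefix y k) :
    ∀ j < k, x j = y j := by
  induction k with
  | zero => simp
  | succ k ih =>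
    have hx := (x k).2
    have hy := (y k).2
    simp only [digitPrefix] at h
    intro j hj
    rcases Nat.lt_succ_iff_lt_or_eq.1 hj with h' | rfl
    · exact ih (by omega) j h'
    · exact Fin.ext (by omega)

lemma ofDigits_eq_digitPrefix_add (x : ℕ → Fin 2) (k : ℕ) :
    2 ^ k * Real.ofDigits x = digitPrefix x k + Real.ofDigits (fun i => x (i + k)) := by
  have h : ∑ i ∈ Finset.range k, Real.ofDigitsTerm x i = digitPrefix x k * ((2 : ℝ) ^ k)⁻¹ := by
    induction k with
    | zero => simp [digitPrefix]
    | succ k ih =>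
      rw [Finset.sum_range_succ, ih]
      simp only [digitPrefix, Real.ofDigitsTerm]
      push_cast
      field_simp
      ring
  rw [Real.ofDigits_eq_sum_add_ofDigits x k, h]
  push_cast
  field_simp

lemma abs_digitPrefix_sub_le (x y : ℕ → Fin 2) (k : ℕ) :
    |(digitPrefix x k : ℝ) - digitPrefix y k| ≤ 2 ^ k * |Real.ofDigits x - Real.ofDigits y| + 1 := by
  have hx := ofDigits_eq_digitPrefix_add x k
  have hy := ofDigits_eq_digitPrefix_add y k
  have e : (2 : ℝ) ^ k * |Real.ofDigits x - Real.ofDigits y| =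
      |2 ^ k * Real.ofDigits x - 2 ^ k * Real.ofDigits y| := by
    rw [← mul_sub, abs_mul, abs_of_pos (a := (2 : ℝ) ^ k) (by positivity)]
  rw [e, hx, hy]
  have h1 := Real.ofDigits_nonneg (fun i => x (i + k))
  have h2 := Real.ofDigits_le_one (fun i => x (i + k))
  have h3 := Real.ofDigits_nonneg (fun i => y (i + k))
  have h4 := Real.ofDigits_le_one (fun i => y (i + k))
  have h5 := abs_add_le ((digitPrefix x k : ℝ) + Real.ofDigits (fun i => x (i + k)) -
    (digitPrefix y k + Real.ofDigits (fun i => y (i + k))))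
    (Real.ofDigits (fun i => y (i + k)) - Real.ofDigits (fun i => x (i + k)))
  have h6 : |Real.ofDigits (fun i => y (i + k)) - Real.ofDigits (fun i => x (i + k))| ≤ 1 :=
    abs_le.2 ⟨by linarith, by linarith⟩
  have e2 : (digitPrefix x k : ℝ) + Real.ofDigits (fun i => x (i + k)) -
    (digitPrefix y k + Real.ofDigits (fun i => y (i + k))) +
    (Real.ofDigits (fun i => y (i + k)) - Real.ofDigits (fun i => x (i + k))) =
    digitPrefix x k - digitPrefix y k := by ring
  rw [e2] at h5
  linarith

/-- Expansions that vanish from position `k` on are integers after scaling by `2 ^ k`, and distinct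
integers differ by at least `1`. -/
lemma inv_le_abs_ofDigits_sub {x y : ℕ → Fin 2} {j k : ℕ} (hjk : j < k) (hxy : x j ≠ y j)
    (hx : ∀ i, k ≤ i → x i = 0) (hy : ∀ i, k ≤ i → y i = 0) :
    ((2 : ℝ) ^ k)⁻¹ ≤ |Real.ofDigits x - Real.ofDigits y| := by
  have hz : Real.ofDigits (fun _ : ℕ => (0 : Fin 2)) = 0 := by
    simp [Real.ofDigits, Real.ofDigitsTerm]
  have e1 := ofDigits_eq_digitPrefix_add x k
  have e2 := ofDigits_eq_digitPrefix_add y k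
  have f1 : (fun i => x (i + k)) = fun _ => 0 := funext fun i => hx _ (by omega)
  have f2 : (fun i => y (i + k)) = fun _ => 0 := funext fun i => hy _ (by omega)
  rw [f1, hz, add_zero] at e1
  rw [f2, hz, add_zero] at e2
  have hne : (digitPrefix x k : ℤ) - digitPrefix y k ≠ 0 := fun h =>
    hxy (digitPrefix_inj (by omega) j hjk)
  have h1 : (1 : ℝ) ≤ |(digitPrefix x k : ℝ) - digitPrefix y k| := by
    exact_mod_cast Int.one_le_abs hne
  rw [inv_eq_one_div, div_le_iff₀ (by positivity)]
  rw [← e1, ← e2, ← mul_sub, abs_mul, abs_of_pos (a := (2 : ℝ) ^ k) (by positivity)] at h1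
  linarith

end Digits

/-! ### Sets with prescribed free binary digits -/

section BinarySet

open scoped Classical in
/-- The binary digits of the `i`-th coordinate that are encoded by `s`. -/
def binaryDigits {d : ℕ} (s : Set (Fin d × ℕ)) (i : Fin d) (j : ℕ) : Fin 2 :=
  if (i, j) ∈ s then 1 else 0

/-- The point of the unit cube whose `i`-th coordinate has the binary digits encoded by `s`. -/
def binaryPoint {d : ℕ} (s : Set (Fin d × ℕ)) : EuclideanSpace ℝ (Fin d) :=
  WithLp.toLp 2 fun i => Real.ofDigits (binaryDigits s i)

/-- The set of points of the unit cube that have binary digits vanishing at all positions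
outside `W`. -/
def binarySet {d : ℕ} (W : Set (Fin d × ℕ)) : Set (EuclideanSpace ℝ (Fin d)) :=
  binaryPoint '' 𝒫 W

open scoped Classical in
/-- The positions of `W` between the levels `l` and `k`. -/
def window {d : ℕ} (W : Set (Fin d × ℕ)) (l k : ℕ) : Finset (Fin d × ℕ) :=
  (Finset.univ ×ˢ Finset.Ico l k).filter (· ∈ W)

variable {d : ℕ} {W : Set (Fin d × ℕ)}

lemma mem_window {l k : ℕ} {p : Fin d × ℕ} : p ∈ window W l k ↔ (l ≤ p.2 ∧ p.2 < k) ∧ p ∈ W := by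
  simp [window]

lemma binarySet_nonempty : (binarySet W).Nonempty :=
  ⟨_, ∅, Set.empty_subset W, rfl⟩

lemma binaryDigits_eq_iff {s t : Set (Fin d × ℕ)} {i : Fin d} {j : ℕ} :
    binaryDigits s i j = binaryDigits t i j ↔ ((i, j) ∈ s ↔ (i, j) ∈ t) := by
  unfold binaryDigits
  split_ifs <;> simp_all

lemma dist_binaryPoint_le {s t : Set (Fin d × ℕ)} {k : ℕ}
    (h : ∀ i, ∀ j < k, binaryDigits s i j = binaryDigits t i j) :
    dist (binaryPoint s) (binaryPoint t) ≤ 2 ^ d * ((2 : ℝ) ^ k)⁻¹ :=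
  EuclideanSpace.dist_le_two_pow_mul (by positivity) fun i => by
    simpa [binaryPoint] using Real.abs_ofDigits_sub_ofDigits_le (h i)

/-- A point is coded by its coordinate prefixes of length `l` and its digits in the window. In a
ball of radius at most `2 ^ (-l)` each prefix integer is within `2` of that of the centre, hence `5
^ d`. The alternative `l = 0`, with empty prefixes, covers large radii. -/
lemma coverNum_binarySet_le {r : ℝ≥0} {R : ℝ} {l k : ℕ} (hl : l = 0 ∨ 2 ^ l * R ≤ 1)
    (hr : 2 ^ d * ((2 : ℝ) ^ k)⁻¹ ≤ r) (x : binarySet W) :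
    coverNum r (Metric.closedBall x R) ≤ (5 ^ d * 2 ^ (window W l k).card : ℕ) := by
  classical
  choose s hsW hs using fun y : binarySet W => y.2
  set T : binarySet W → Fin d → ℤ := fun y i => digitPrefix (binaryDigits (s y) i) l
  refine (coverNum_le_of_code (fun y => (T y, (window W l k).filter (· ∈ s y)))
    ((Fintype.piFinset fun i => Finset.Icc (T x i - 2) (T x i + 2)) ×ˢ (window W l k).powerset)
    (fun y hy => ?_) fun y _ z _ hyz => ?_).trans (le_of_eq ?_)
  · refine Finset.mem_product.2 ⟨Fintype.mem_piFinset.2 fun i => Finset.mem_Icc.2 ?_,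
      Finset.mem_powerset.2 (Finset.filter_subset _ _)⟩
    rcases hl with rfl | hl
    · simp [T, digitPrefix]
    have h1 := abs_digitPrefix_sub_le (binaryDigits (s y) i) (binaryDigits (s x) i) l
    have h2 := EuclideanSpace.abs_sub_le_dist y.1 x.1 i
    rw [← hs y, ← hs x] at h2
    have h3 : dist (binaryPoint (s y)) (binaryPoint (s x)) ≤ R := by
      rw [hs y, hs x]; exact hy
    have h4 : |(digitPrefix (binaryDigits (s y) i) l : ℝ) - digitPrefix (binaryDigits (s x) i) l| ≤
        2 := by
      refine h1.trans ?_
      have : (2 : ℝ) ^ l * |Real.ofDigits (binaryDigits (s y) i) -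
          Real.ofDigits (binaryDigits (s x) i)| ≤ 2 ^ l * R := by
        gcongr
        exact h2.trans h3
      linarith
    have h5 : |T y i - T x i| ≤ 2 := by
      have : ((|T y i - T x i| : ℤ) : ℝ) ≤ 2 := by simpa [T] using h4
      exact_mod_cast this
    rw [abs_le] at h5
    constructor <;> linarith [h5.1, h5.2]
  · refine le_trans ?_ hr
    show dist y.1 z.1 ≤ _
    rw [← hs y, ← hs z]
    refine dist_binaryPoint_le fun i j hj => ?_
    have h1 : T y = T z := congrArg Prod.fst hyz
    have h2 : (window W l k).filter (· ∈ s y) = (window W l k).filter (· ∈ s z) :=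
      congrArg Prod.snd hyz
    rcases lt_or_ge j l with h | h
    · exact digitPrefix_inj (by simpa [T] using congrFun h1 i) j h
    · rw [binaryDigits_eq_iff]
      have h3 := Finset.ext_iff.1 h2 (i, j)
      simp only [Finset.mem_filter, mem_window] at h3
      exact ⟨fun h4 => (h3.1 ⟨⟨⟨h, hj⟩, hsW y h4⟩, h4⟩).2,
        fun h4 => (h3.2 ⟨⟨⟨h, hj⟩, hsW z h4⟩, h4⟩).2⟩
  · have e : ∀ i, (Finset.Icc (T x i - 2) (T x i + 2)).card = 5 := fun i => by
      rw [Int.card_Icc]; ring_nf; rfl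
    rw [Finset.card_product, Fintype.card_piFinset, Finset.card_powerset]
    simp [e]

/-- Keep the digits of the centre below level `l`, choose those in the window freely, and put zeros
from level `k` on. The zeros avoid the ambiguity of binary expansions, so different choices are at
least `2 ^ (-k)` apart. -/
lemma le_packNum_binarySet {r : ℝ≥0} {R : ℝ} {l k : ℕ} (hl : 2 ^ d * ((2 : ℝ) ^ l)⁻¹ ≤ R)
    (hr : 4 * (r : ℝ) < ((2 : ℝ) ^ k)⁻¹) (x : binarySet W) :
    ((2 ^ (window W l k).card : ℕ) : ℕ∞) ≤ packNum r (Metric.closedBall x R) := by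
  classical
  obtain ⟨x, s, hsW, rfl⟩ := x
  set a : Finset (Fin d × ℕ) → Set (Fin d × ℕ) := fun t =>
    (s ∩ {p | p.2 < l}) ∪ ((t ∩ window W l k : Finset _) : Set (Fin d × ℕ)) with ha
  have haW : ∀ t, a t ⊆ W := fun t p hp => by
    rcases hp with hp | hp
    · exact hsW hp.1
    · exact (mem_window.1 (Finset.mem_inter.1 hp).2).2
  set c : Finset (Fin d × ℕ) → binarySet W := fun t => ⟨binaryPoint (a t), a t, haW t, rfl⟩
  have hsep : ∀ t ∈ (window W l k).powerset, ∀ t' ∈ (window W l k).powerset, t ≠ t' →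
      4 * (r : ℝ) < dist (c t) (c t') := by
    intro t ht t' ht' hne
    rw [Finset.mem_powerset] at ht ht'
    obtain ⟨⟨i, j⟩, hij⟩ : ∃ p, ¬(p ∈ t ↔ p ∈ t') := by
      by_contra! h
      exact hne (Finset.ext h)
    have hw : (i, j) ∈ window W l k := by
      by_contra hw
      exact hij ⟨fun h => absurd (ht h) hw, fun h => absurd (ht' h) hw⟩
    have hlj := (mem_window.1 hw).1
    refine hr.trans_le (le_trans ?_ (EuclideanSpace.abs_sub_le_dist _ _ i))
    have hz : ∀ t, ∀ n, k ≤ n → binaryDigits (a t) i n = 0 := fun t n hn => by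
      have : (i, n) ∉ a t := by
        rintro (h | h)
        · have h1 : n < l := h.2
          simp only at hlj
          omega
        · have h1 := (mem_window.1 (Finset.mem_inter.1 h).2).1.2
          simp only at h1
          omega
      simp [binaryDigits, this]
    refine inv_le_abs_ofDigits_sub hlj.2 ?_ (hz t) (hz t')
    rw [Ne, binaryDigits_eq_iff]
    have hm : ∀ t, (i, j) ∈ a t ↔ (i, j) ∈ t := fun t => by
      have : ¬j < l := by simp only at hlj; omega
      simp [ha, this, hw]
    rwa [hm, hm]
  have hcard : ((window W l k).powerset.image c).card = 2 ^ (window W l k).card := by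
    rw [Finset.card_image_of_injOn, Finset.card_powerset]
    intro t ht t' ht' h
    by_contra hne
    have := hsep t ht t' ht' hne
    rw [h, dist_self] at this
    exact absurd this (not_lt.2 (by positivity))
  rw [← hcard]
  refine card_le_packNum _ (fun y hy => ?_) fun y hy z hz hyz => ?_
  · obtain ⟨t, -, rfl⟩ := Finset.mem_image.1 hy
    refine Metric.mem_closedBall.2 (le_trans ?_ hl)
    refine dist_binaryPoint_le fun i j hj => ?_
    rw [binaryDigits_eq_iff]
    have : (i, j) ∉ window W l k := fun h => by
      have := (mem_window.1 h).1.1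
      simp only at this
      omega
    simp [ha, this, hj]
  · obtain ⟨t, ht, rfl⟩ := Finset.mem_image.1 hy
    obtain ⟨t', ht', rfl⟩ := Finset.mem_image.1 hz
    exact hsep t ht t' ht' fun h => hyz (h ▸ rfl)

/-- The positions such that there are `M (j + 1) - M j` free coordinates at level `j`. -/
def freePositions (d : ℕ) (M : ℕ → ℕ) : Set (Fin d × ℕ) := {p | (p.1 : ℕ) < M (p.2 + 1) - M p.2}

lemma card_window_freePositions {M : ℕ → ℕ} (hM : Monotone M) (hd : ∀ k, M (k + 1) ≤ M k + d)
    (l k : ℕ) : (window (freePositions d M) l k).card = M k - M l := by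
  classical
  have h1 : ∀ j, (∑ i : Fin d, if (i, j) ∈ freePositions d M then 1 else 0) = M (j + 1) - M j := by
    intro j
    rw [← Finset.card_filter]
    have := Fin.card_filter_val_lt (n := d) (m := M (j + 1) - M j)
    rw [min_eq_right (by have := hd j; omega)] at this
    refine (congrArg Finset.card (Finset.ext fun i => ?_)).trans this
    rw [Finset.mem_filter_univ, Finset.mem_filter_univ]
    rfl
  rw [window, Finset.card_filter, Finset.sum_product_right, Finset.sum_congr rfl fun j _ => h1 j]
  rcases le_total l k with h | h
  · induction k, h using Nat.le_induction with
    | base => simp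
    | succ k hlk ih =>
      rw [Finset.sum_Ico_succ_top hlk, ih]
      have := hM hlk
      have := hM (show k ≤ k + 1 by omega)
      omega
  · have := hM h
    rw [Finset.Ico_eq_empty (by omega), Finset.sum_empty]
    omega

end BinarySet

/-! ### Realization by a uniform set -/

section Realization

lemma le_add_mul_of_succ_le {f : ℕ → ℝ} {d : ℝ} (hd : ∀ k, f (k + 1) ≤ f k + d) (k n : ℕ) :
    f (k + n) ≤ f k + n * d := by
  induction n with
  | zero => simp
  | succ n ih => have := hd (k + n); rw [← add_assoc]; push_cast; linarith

/-- The free positions follow the integer parts of `f`. Every ball has the same number of free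
digits in its window, so suprema and infima agree up to a constant; rounding of scales costs a
bounded number of levels, each worth at most `d`. -/
lemma exists_set_realLogTwo_near {d : ℕ} {f : ℕ → ℝ} (h0 : f 0 = 0) (hmono : Monotone f)
    (hd : ∀ k, f (k + 1) ≤ f k + d) :
    ∃ F : Set (EuclideanSpace ℝ (Fin d)), F.Nonempty ∧ ∃ c : ℝ, ∀ u v : ℝ, v ≤ u →
      realLogTwo (supCover F u v) ≤ f ⌊u⌋₊ - f ⌊v⌋₊ + c ∧
      f ⌊u⌋₊ - f ⌊v⌋₊ - c ≤ realLogTwo (infPack F u v) := by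
  have hf0 : ∀ k, 0 ≤ f k := fun k => h0 ▸ hmono (Nat.zero_le k)
  set M : ℕ → ℕ := fun k => ⌊f k⌋₊ with hM
  have hMmono : Monotone M := fun a b h => Nat.floor_mono (hmono h)
  have hMd : ∀ k, M (k + 1) ≤ M k + d := fun k => by
    show ⌊f (k + 1)⌋₊ ≤ ⌊f k⌋₊ + d
    rw [← Nat.floor_add_natCast (hf0 k)]
    exact Nat.floor_mono (hd k)
  have hMle : ∀ k, (M k : ℝ) ≤ f k := fun k => Nat.floor_le (hf0 k)
  have hltM : ∀ k, f k < M k + 1 := fun k => Nat.lt_floor_add_one _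
  set F := binarySet (freePositions d M) with hF
  have hFne : F.Nonempty := binarySet_nonempty
  have : Nonempty F := hFne.to_subtype
  refine ⟨F, hFne, 3 * d + d * (d + 1) + 1, fun u v huv => ⟨?_, ?_⟩⟩
  · set k := ⌈u⌉₊ + d
    set l := ⌊v⌋₊
    have hlk : l ≤ k := (Nat.floor_mono huv).trans ((Nat.floor_le_ceil u).trans (by omega))
    have hl : l = 0 ∨ (2 : ℝ) ^ l * 2 ^ (-v) ≤ 1 := by
      rcases le_total v 0 with h | h
      · exact Or.inl (Nat.floor_of_nonpos h)
      · right
        rw [← Real.rpow_natCast, ← Real.rpow_add (by norm_num)]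
        exact Real.rpow_le_one_of_one_le_of_nonpos (by norm_num) (by linarith [Nat.floor_le h])
    have hr : (2 : ℝ) ^ d * (2 ^ k)⁻¹ ≤ ((2 : ℝ≥0) ^ (-u) : ℝ≥0) := by
      rw [coe_two_rpow, ← Real.rpow_natCast, ← Real.rpow_natCast, ← Real.rpow_neg (by norm_num),
        ← Real.rpow_add (by norm_num)]
      refine Real.rpow_le_rpow_of_exponent_le (by norm_num) ?_
      have := Nat.le_ceil u
      simp only [k]; push_cast; linarith
    have h1 : supCover F u v ≤ (2 ^ (3 * d + (M k - M l)) : ℕ) := by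
      refine iSup_le fun x => (coverNum_binarySet_le hl hr x).trans ?_
      rw [card_window_freePositions hMmono hMd, pow_add, pow_mul]
      have : 5 ^ d * 2 ^ (M k - M l) ≤ (2 ^ 3) ^ d * 2 ^ (M k - M l) := by gcongr; norm_num
      exact_mod_cast this
    have h2 := realLogTwo_le (ne_bot_of_le_ne_bot (infPack_ne_zero u v)
      ((infPack_le_infCover u v).trans (infCover_le_supCover u v))) (ENat.natCast_ne_top _) h1
    rw [realLogTwo_two_pow] at h2
    have h3 : k ≤ ⌊u⌋₊ + (d + 1) := by
      have := Nat.ceil_le_floor_add_one u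
      omega
    have h4 := (hmono h3).trans (le_add_mul_of_succ_le hd _ _)
    push_cast [Nat.cast_sub (hMmono hlk)] at h2 h4
    linarith [hMle k, hltM l]
  -- Two levels absorb the factor `4` in the separation and the third makes the inequality strict.
  -- When the truncated subtraction gives `k = 0`, the claimed count is `1`.
  · set k := ⌊u⌋₊ - 3
    set l := ⌈v⌉₊ + d
    have hl : (2 : ℝ) ^ d * (2 ^ l)⁻¹ ≤ 2 ^ (-v) := by
      rw [← Real.rpow_natCast, ← Real.rpow_natCast, ← Real.rpow_neg (by norm_num),
        ← Real.rpow_add (by norm_num)]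
      refine Real.rpow_le_rpow_of_exponent_le (by norm_num) ?_
      have := Nat.le_ceil v
      simp only [l]; push_cast; linarith
    have h1 : ((2 ^ (M k - M l) : ℕ) : ℕ∞) ≤ infPack F u v := by
      rcases Nat.lt_or_ge ⌊u⌋₊ 3 with h | h
      · have hk : k = 0 := by omega
        have : M k - M l = 0 := by
          rw [hk]; have := hMmono (Nat.zero_le l); omega
        rw [this]
        simpa using Order.one_le_iff_ne_zero.2 (infPack_ne_zero (X := F) u v)
      · refine le_iInf fun x => ?_
        rw [← card_window_freePositions hMmono hMd]
        refine le_packNum_binarySet hl ?_ x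
        have hu : ((⌊u⌋₊ : ℕ) : ℝ) ≤ u := Nat.floor_le (by
          by_contra! hneg
          rw [Nat.floor_of_nonpos hneg.le] at h
          omega)
        have hk : (k : ℝ) = ⌊u⌋₊ - 3 := by simp only [k]; rw [Nat.cast_sub h]; norm_num
        rw [coe_two_rpow, ← Real.rpow_natCast, ← Real.rpow_neg (by norm_num),
          show (4 : ℝ) = 2 ^ (2 : ℝ) by norm_num, ← Real.rpow_add (by norm_num)]
        refine Real.rpow_lt_rpow_of_exponent_lt (by norm_num) ?_
        rw [hk]; linarith
    have hfin : infPack F u v ≠ ⊤ := by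
      obtain ⟨K, hK⟩ := exists_supCover_le d
      exact ne_top_of_le_ne_top (hK F hFne u v huv).1
        ((infPack_le_infCover u v).trans (infCover_le_supCover u v))
    have h2 := realLogTwo_le (by simp) hfin h1
    rw [realLogTwo_two_pow] at h2
    have h3 : l ≤ ⌊v⌋₊ + (d + 1) := by
      have := Nat.ceil_le_floor_add_one v
      omega
    have h4 := (hmono h3).trans (le_add_mul_of_succ_le hd _ _)
    have h5 := (hmono (show ⌊u⌋₊ ≤ k + 3 by omega)).trans (le_add_mul_of_succ_le hd _ _)
    have h6 : (M k : ℝ) - M l ≤ (M k - M l : ℕ) := by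
      rw [sub_le_iff_le_add]
      exact_mod_cast (show M k ≤ M k - M l + M l by omega)
    push_cast at h4 h5
    linarith [hMle l, hltM k]

lemma IsScaleKernel.hasScaledLiminf_of_near {d : ℝ} (hd : 0 ≤ d) {φ : ℝ → ℝ}
    (hg : IsScaleKernel d fun u v => u * φ (v / u)) {θ c : ℝ} (hθ : θ ∈ Ioo (0 : ℝ) 1) {A : ℝ → ℝ}
    (hA : ∀ u > 0, |A u - (profile d (fun u v => u * φ (v / u)) ⌊u⌋₊ -
      profile d (fun u v => u * φ (v / u)) ⌊θ * u⌋₊)| ≤ c) : HasScaledLiminf A (φ θ) := by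
  set g : ℝ → ℝ → ℝ := fun u v => u * φ (v / u) with hgdef
  have hgθ : ∀ u > 0, g u (θ * u) = φ θ * u := fun u hu => by
    simp only [hgdef]; rw [mul_div_cancel_right₀ _ hu.ne', mul_comm]
  obtain ⟨hθ0, hθ1⟩ := hθ
  constructor
  · intro ε hε
    have hε' : 0 < ε / 2 := by positivity
    filter_upwards [tendsto_nat_floor_atTop.eventually (hg.eventually_le_profile_sub hd hε'),
      eventually_gt_atTop 0, eventually_const_le_mul 1 hθ0, eventually_const_le_mul (c + d) hε']
      with u h1 hu h2 h3
    have hle : θ * u ≤ u := mul_le_of_le_one_left hu.le hθ1.le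
    have hj : 1 ≤ ⌊θ * u⌋₊ := Nat.le_floor (by simpa using h2)
    have hj' : (0 : ℝ) < ⌊θ * u⌋₊ := by exact_mod_cast hj
    have hjk : ⌊θ * u⌋₊ ≤ ⌊u⌋₊ := Nat.floor_mono hle
    have hku : (⌊u⌋₊ : ℝ) ≤ u := Nat.floor_le hu.le
    have hju : (⌊θ * u⌋₊ : ℝ) ≤ θ * u := Nat.floor_le (by positivity)
    have a1 := h1 _ hj hjk
    have a2 := hg.lip_left hj' (by exact_mod_cast hjk) hku
    have a3 := hg.anti_right hj' hju hle
    rw [hgθ u hu] at a3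
    have a4 := (abs_le.1 (hA u hu)).1
    have a5 : d * (u - ⌊u⌋₊) ≤ d * 1 := by
      gcongr; linarith [Nat.lt_floor_add_one u]
    have a6 : ε / 2 * ⌊u⌋₊ ≤ ε / 2 * u := by gcongr
    linarith
  · intro ε hε
    -- The upper bound is needed only along a sequence, so integer scales suffice. There equality is
    -- invoked with `δ = θ / 2`, which leaves room for rounding `θ * k` down.
    refine tendsto_natCast_atTop_atTop.frequently
      (p := fun u : ℝ => A u ≤ (φ θ + ε) * u) ?_
    have ht : Tendsto (fun n : ℕ => (n : ℝ)) atTop atTop := tendsto_natCast_atTop_atTop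
    refine ((hg.frequently_profile_sub_eq (half_pos hθ0)).and_eventually
      ((eventually_gt_atTop 0).and ((ht.eventually (eventually_const_le_mul 1 (half_pos hθ0))).and
        (ht.eventually (eventually_const_le_mul (c + d) hε))))).mono ?_
    rintro k ⟨h1, hk, h2, h3⟩
    have hk' : (0 : ℝ) < k := by exact_mod_cast hk
    have hle : θ * k ≤ k := mul_le_of_le_one_left hk'.le hθ1.le
    have hju : (⌊θ * k⌋₊ : ℝ) ≤ θ * k := Nat.floor_le (by positivity)
    have hlt := Nat.lt_floor_add_one (θ * (k : ℝ))
    have hjk : ⌊θ * k⌋₊ ≤ k := by exact_mod_cast hju.trans hle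
    have hj' : (0 : ℝ) < ⌊θ * k⌋₊ := by linarith
    have a1 := h1 ⌊θ * k⌋₊ (by linarith) hjk
    have a2 := hg.lip_right hj' hju hle
    rw [hgθ k hk'] at a2
    have a3 := (abs_le.1 (hA k hk')).2
    rw [Nat.floor_natCast, a1] at a3
    have a5 : d * (θ * k - ⌊θ * k⌋₊) ≤ d * 1 := by
      gcongr; linarith
    linarith

lemma exists_uniform_hasScaledLowerSpectrum {d : ℕ} {φ : ℝ → ℝ}
    (h0 : MapsTo φ (Ioc 0 1) (Icc 0 (d : ℝ)))
    (h1 : LipschitzOnWith (d : ℝ≥0) φ (Ioc 0 1))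
    (h2 : ∀ l ∈ Ioc (0 : ℝ) 1, ∀ θ ∈ Ioc (0 : ℝ) 1, φ θ ≤ φ (l * θ) - θ * φ l) :
    ∃ F : Set (EuclideanSpace ℝ (Fin d)),
      F.Nonempty ∧ IsUniformSpaceAtScales F ∧ HasScaledLowerSpectrum F φ := by
  have hg := isScaleKernel_of_superadd h0 h1 h2
  have hd : (0 : ℝ) ≤ d := Nat.cast_nonneg d
  obtain ⟨F, hF, c, hc⟩ := exists_set_realLogTwo_near (d := d)
    (f := profile d fun u v => u * φ (v / u)) (by simp [profile]) (hg.profile_mono hd)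
    (fun k => by linarith [(hg.profile_succ_sub_mem hd k).2])
  have : Nonempty F := hF.to_subtype
  obtain ⟨K, hK⟩ := exists_supCover_le d
  have hS : ∀ u v : ℝ, v ≤ u → supCover F u v ≠ ⊤ := fun u v h => (hK F hF u v h).1
  have hA : ∀ u v : ℝ, v ≤ u → infCover F u v ≠ ⊤ := fun u v h =>
    ne_top_of_le_ne_top (hS u v h) (infCover_le_supCover u v)
  have hspec : ∀ θ ∈ Ioo (0 : ℝ) 1,
      ENNReal.ofReal (1 - θ) * lowerSpectrum θ F = ENNReal.ofReal (φ θ) := by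
    intro θ hθ
    rw [ofReal_mul_lowerSpectrum_eq_iff hθ (h0 ⟨hθ.1, hθ.2.le⟩).1 hA]
    refine hg.hasScaledLiminf_of_near hd hθ (c := c) fun u hu => ?_
    have hle : θ * u ≤ u := mul_le_of_le_one_left hu.le hθ.2.le
    have a1 := hc u (θ * u) hle
    have a2 := realLogTwo_le (infPack_ne_zero u (θ * u)) (hA _ _ hle)
      (infPack_le_infCover (X := F) u (θ * u))
    have a3 := realLogTwo_le (ne_bot_of_le_ne_bot (infPack_ne_zero u (θ * u))
      (infPack_le_infCover u (θ * u))) (hS _ _ hle) (infCover_le_supCover (X := F) u (θ * u))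
    exact abs_le.2 ⟨by linarith, by linarith⟩
  refine ⟨F, hF, ⟨fun _ => 2 * c, (isUniformWith_iff hS).2 ⟨?_, fun u v huv => ?_⟩⟩, hspec, ?_⟩
  · simpa using tendsto_inv_atTop_zero.mul_const (2 * c)
  · have := hc u v huv
    linarith
  -- The limit defining the value at `1` is the continuity of the Lipschitz function `φ`.
  · have hcont : Tendsto φ (𝓝[<] 1) (𝓝 (φ 1)) :=
      (h1.continuousOn 1 (by simp)).mono_left (nhdsWithin_le_of_mem
        (mem_of_superset (Ioo_mem_nhdsLT (show (0 : ℝ) < 1 by norm_num)) Ioo_subset_Ioc_self))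
    refine ((ENNReal.continuous_ofReal.tendsto _).comp hcont).congr' ?_
    filter_upwards [Ioo_mem_nhdsLT (show (0 : ℝ) < 1 by norm_num)] with θ hθ
    exact (hspec θ hθ).symm

end Realization

end

theorem theoremC (d : ℕ) :
    (∀ φ : ℝ → ℝ, MapsTo φ (Ioc 0 1) (Icc 0 (d : ℝ)) →
      ((∃ F : Set (EuclideanSpace ℝ (Fin d)),
          F.Nonempty ∧ IsUniformSpaceAtScales F ∧ HasScaledLowerSpectrum F φ) ↔
        LipschitzOnWith (d : ℝ≥0) φ (Ioc 0 1) ∧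
          ∀ l ∈ Ioc (0 : ℝ) 1, ∀ θ ∈ Ioc (0 : ℝ) 1, φ θ ≤ φ (l * θ) - θ * φ l)) ∧
    (0 < d → classU d ⊂ classH d) := by
  refine ⟨fun φ h0 => ⟨?_, fun h => exists_uniform_hasScaledLowerSpectrum h0 h.1 h.2⟩,
    classU_ssubset_classH⟩
  rintro ⟨F, hF, hunif, hφ⟩
  exact lipschitzOn_and_superadd_of_isUniform hF hunif h0 hφ
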